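/- Let $R$ be a commutative ring. Functors are covariant functors on commutative $R$-algebras; $\mathcal R$ is the functor $\mathcal R(S)=S$, and a functor of $\mathcal R$-modules is a functor $\mathbb M$ with an $S$-module structure on each $\mathbb M(S)$, compatible with base change. For an $R$-module $M$ the module scheme $\mathcal M^*$ is the functor $\mathcal M^*(S)=\mathrm{Hom}_R(M,S)$. In the category of module schemes, the cokernel of the morphism $\mathcal M^*\to\mathcal N^*$ dual to a linear map $h\colon N\to M$ is $\mathcal K^*$ with $K=\mathrm{Ker}\,h$; quotients of module schemes are taken in this sense. The module scheme closure of a functor of $\mathcal R$-modules $\mathbb M$ is $\overline{\mathbb M}=\mathcal D^*$, where $D=\mathrm{Hom}_{\mathcal R}(\mathbb M,\mathcal R)$, with its canonical morphism $\mathbb M\to\overline{\mathbb M}$. The module scheme closure of a subfunctor $\mathbb F$ of a module scheme $\mathcal M^*$ in $\mathcal M^*$ is $(\mathcal M/\mathcal K)^*$, where $K\subseteq M$ is the submodule of the elements on which all $f\in\mathbb F(S)$, for all $S$, vanish. $S^n\mathbb M$ is the functor $S\mapsto S^n_S(\mathbb M(S))$ ($n$-th symmetric power of the $S$-module $\mathbb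 M(S)$). Let $\mathcal A^*$ be a commutative bialgebra scheme, that is, $\mathcal A^*(S)=\mathrm{Hom}_R(A,S)$ for a cocommutative $R$-bialgebra $A$, with the convolution product dual to the coproduct of $A$; let $e\colon\mathcal A^*\to\mathcal R$, $f\mapsto f(1)$, be its counit and $\mathcal I^*=\mathrm{Ker}\,e$. Let $\mathcal I^{*n}$ be the module scheme closure in $\mathcal A^*$ of the subfunctor $S\mapsto\mathcal I^*(S)^n$ (powers of ideals of the ring $\mathcal A^*(S)$; so $\mathcal I^{*0}=\mathcal A^*$). We say that $\mathbb G=\mathrm{Spec}\,\mathcal A^*$ is a flat infinitesimal formal monoid if 1. $A$ is a flat $R$-module; 2. $\mathcal A^*=\varprojlim_i\mathcal A^*/\mathcal I^{*i}$; 3. $(\mathcal I^{*n})_{|S}=(\mathcal I^*{}_{|S})^n$ for all $n$ and all base changes $R\to S$, where $_{|S}$ denotes the restriction of a functor to commutative $S$-algebras and the right-hand side is formed for the bialgebra scheme $\mathcal A^*{}_{|S}=(\mathcal A\otimes_R S)^*$ over $S$. **Theorem.** Let $R$ be a commutative ring that is flat over $\mathbb Z$ and let $\mathbb G=\mathrm{Spec}\,\mathcal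 A^*$ be a flat infinitesimal formal monoid over $R$. Then for every $n\ge 0$ there is a unique morphism of functors of $\mathcal R$-modules $$m\colon\overline{S^n(\mathcal I^*/\mathcal I^{*2})}\longrightarrow\mathcal I^{*n}/\mathcal I^{*n+1}$$ that is induced by multiplication, i.e. that maps (the image in the closure of) $[f_1]\cdots[f_n]$ to $[f_1\cdots f_n]$ for all commutative $R$-algebras $S$ and all $f_1,\dots,f_n\in\mathcal I^*(S)$, and this natural morphism $m$ is an isomorphism. -/

import Mathlib

open scoped TensorProduct

universe u v w w₁ w₂ w₃

/-! ## Functors of modules over commutative algebras -/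

/-- A functor of `𝓡`-modules: a covariant functor `S ↦ 𝕄(S)` on commutative `R`-algebras such that
`𝕄(S)` is an `S`-module and the transition maps are semilinear. -/
structure ModuleFunctor (R : Type u) [CommRing R] where
  obj : ∀ (S : Type u) [CommRing S] [Algebra R S], Type w
  [addCommGroup : ∀ (S : Type u) [CommRing S] [Algebra R S], AddCommGroup (obj S)]
  [module : ∀ (S : Type u) [CommRing S] [Algebra R S], Module S (obj S)]
  map : ∀ {S T : Type u} [CommRing S] [Algebra R S] [CommRing T] [Algebra R T]
    (φ : S →ₐ[R] T), obj S →ₛₗ[(φ : S →+* T)] obj T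
  map_id : ∀ (S : Type u) [CommRing S] [Algebra R S] (x : obj S), map (AlgHom.id R S) x = x
  map_comp : ∀ {S T U : Type u} [CommRing S] [Algebra R S] [CommRing T] [Algebra R T]
    [CommRing U] [Algebra R U] (φ : S →ₐ[R] T) (ψ : T →ₐ[R] U) (x : obj S),
    map (ψ.comp φ) x = map ψ (map φ x)

namespace ModuleFunctor

variable {R : Type u} [CommRing R]

instance (M : ModuleFunctor.{u, w} R) (S : Type u) [CommRing S] [Algebra R S] :
    AddCommGroup (M.obj S) := M.addCommGroup S

instance (M : ModuleFunctor.{u, w} R) (S : Type u) [CommRing S] [Algebra R S] :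
    Module S (M.obj S) := M.module S

/-- Morphisms of functors of `𝓡`-modules: natural families of `S`-linear maps. -/
@[ext]
structure Hom (M : ModuleFunctor.{u, w₁} R) (N : ModuleFunctor.{u, w₂} R) where
  app : ∀ (S : Type u) [CommRing S] [Algebra R S], M.obj S →ₗ[S] N.obj S
  naturality : ∀ {S T : Type u} [CommRing S] [Algebra R S] [CommRing T] [Algebra R T]
    (φ : S →ₐ[R] T) (x : M.obj S), app T (M.map φ x) = N.map φ (app S x)

namespace Hom

/-- The identity morphism. -/
def id (M : ModuleFunctor.{u, w} R) : Hom M M where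
  app _ _ _ := LinearMap.id
  naturality _ _ := rfl

/-- Composition of morphisms, `f` first. -/
def comp {M : ModuleFunctor.{u, w₁} R} {N : ModuleFunctor.{u, w₂} R} {P : ModuleFunctor.{u, w₃} R}
    (g : Hom N P) (f : Hom M N) : Hom M P where
  app S _ _ := g.app S ∘ₗ f.app S
  naturality φ x := by simp [f.naturality, g.naturality]

/-- A morphism of functors of modules is an isomorphism if it has a two-sided inverse. -/
def IsIso {M : ModuleFunctor.{u, w₁} R} {N : ModuleFunctor.{u, w₂} R} (f : Hom M N) : Prop :=
  ∃ g : Hom N M, g.comp f = Hom.id M ∧ f.comp g = Hom.id N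

end Hom

/-- The functor of rings `𝓡`, `𝓡(S) = S`, regarded as a functor of modules. -/
def base (R : Type u) [CommRing R] : ModuleFunctor.{u, u} R where
  obj S _ _ := S
  addCommGroup _ _ _ := inferInstance
  module _ _ _ := inferInstance
  map φ := { toFun := φ, map_add' := map_add φ, map_smul' := fun s x => map_mul φ s x }
  map_id _ _ _ _ := rfl
  map_comp _ _ _ := rfl

/-- `𝕄^*(R)`, the linear forms on the functor `𝕄`: the morphisms `𝕄 → 𝓡`. -/
abbrev Dual (M : ModuleFunctor.{u, w} R) : Type (max (u + 1) w) := Hom M (base R)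

namespace Dual

variable (M : ModuleFunctor.{u, w} R)

/-- The linear form `x ↦ φ_S(x) ∈ S`. -/
def val {M : ModuleFunctor.{u, w} R} (φ : Dual M) (S : Type u) [CommRing S] [Algebra R S] :
    M.obj S →ₗ[S] S := φ.app S

variable {M} in
theorem val_map (φ : Dual M) {S T : Type u} [CommRing S] [Algebra R S] [CommRing T] [Algebra R T]
    (ψ : S →ₐ[R] T) (x : M.obj S) : φ.val T (M.map ψ x) = ψ (φ.val S x) := φ.naturality ψ x

instance : Zero (Dual M) where
  zero := { app := fun S _ _ => (0 : M.obj S →ₗ[S] S), naturality := fun φ _ => (map_zero φ).symm }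

instance : Add (Dual M) where
  add f g :=
    { app := fun S _ _ => f.val S + g.val S
      naturality := fun φ x => by
        change f.val _ _ + g.val _ _ = φ (f.val _ x + g.val _ x)
        rw [val_map, val_map, map_add] }

instance : Neg (Dual M) where
  neg f :=
    { app := fun S _ _ => -f.val S
      naturality := fun φ x => by
        change -f.val _ _ = φ (-f.val _ x)
        rw [val_map, map_neg] }

instance : SMul R (Dual M) where
  smul r f :=
    { app := fun S _ _ => algebraMap R S r • f.val S
      naturality := fun {S T} _ _ _ _ φ x => by
        change algebraMap R T r * f.val _ _ = φ (algebraMap R S r * f.val _ x)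
        rw [val_map, map_mul, AlgHom.commutes] }

variable {M} in
theorem ext_val {f g : Dual M} (h : ∀ (S : Type u) [CommRing S] [Algebra R S] (x : M.obj S),
    f.val S x = g.val S x) : f = g :=
  Hom.ext (by funext S _ _; exact LinearMap.ext (h S))

theorem zero_val (S : Type u) [CommRing S] [Algebra R S] (x : M.obj S) :
    (0 : Dual M).val S x = 0 := rfl

variable {M} in
theorem add_val (f g : Dual M) (S : Type u) [CommRing S] [Algebra R S] (x : M.obj S) :
    (f + g).val S x = f.val S x + g.val S x := rfl

variable {M} in
theorem neg_val (f : Dual M) (S : Type u) [CommRing S] [Algebra R S] (x : M.obj S) :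
    (-f).val S x = -f.val S x := rfl

variable {M} in
theorem smul_val (r : R) (f : Dual M) (S : Type u) [CommRing S] [Algebra R S] (x : M.obj S) :
    (r • f).val S x = algebraMap R S r * f.val S x := rfl

instance : AddCommGroup (Dual M) where
  add_assoc f g h := ext_val fun S _ _ x => by simp only [add_val, add_assoc]
  zero_add f := ext_val fun S _ _ x => by simp only [add_val, zero_val, zero_add]
  add_zero f := ext_val fun S _ _ x => by simp only [add_val, zero_val, add_zero]
  neg_add_cancel f := ext_val fun S _ _ x => by
    simp only [add_val, zero_val, neg_val, neg_add_cancel]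
  add_comm f g := ext_val fun S _ _ x => by simp only [add_val, add_comm]
  nsmul := nsmulRec
  zsmul := zsmulRec

instance : Module R (Dual M) where
  one_smul f := ext_val fun S _ _ x => by simp only [smul_val, map_one, one_mul]
  mul_smul r s f := ext_val fun S _ _ x => by simp only [smul_val, map_mul, mul_assoc]
  smul_zero r := ext_val fun S _ _ x => by simp only [smul_val, zero_val, mul_zero]
  smul_add r f g := ext_val fun S _ _ x => by simp only [smul_val, add_val, mul_add]
  add_smul r s f := ext_val fun S _ _ x => by simp only [smul_val, add_val, map_add, add_mul]
  zero_smul f := ext_val fun S _ _ x => by simp only [smul_val, zero_val, map_zero, zero_mul]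

end Dual

/-! ## Module schemes -/

/-- The module scheme `𝓜^*` of an `R`-module `M`: `𝓜^*(S) = Hom_R(M, S)`. -/
def moduleScheme (R : Type u) [CommRing R] (M : Type v) [AddCommGroup M] [Module R M] :
    ModuleFunctor.{u, max u v} R where
  obj S _ _ := M →ₗ[R] S
  addCommGroup _ _ _ := inferInstance
  module _ _ _ := inferInstance
  map φ :=
    { toFun := fun f => φ.toLinearMap ∘ₗ f
      map_add' := fun f g => by ext; simp
      map_smul' := fun s f => by ext; simp }
  map_id _ _ _ _ := rfl
  map_comp _ _ _ := rfl

/-- The dual morphism `𝓜^* → 𝓝^*` of a linear map `N → M`. -/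
def moduleSchemeMap {M N : Type v} [AddCommGroup M] [Module R M] [AddCommGroup N] [Module R N]
    (h : N →ₗ[R] M) : Hom (moduleScheme R M) (moduleScheme R N) where
  app S _ _ :=
    { toFun := fun (f : M →ₗ[R] S) => f ∘ₗ h
      map_add' := fun _ _ => rfl
      map_smul' := fun _ _ => rfl }
  naturality _ _ := rfl

/-- The cokernel, in the category of module schemes, of the dual morphism `𝓜^* → 𝓝^*` of a linear
map `h : N → M`: it is the module scheme of `Ker h`. -/
abbrev moduleSchemeCoker {M N : Type v} [AddCommGroup M] [Module R M] [AddCommGroup N] [Module R N]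
    (h : N →ₗ[R] M) : ModuleFunctor.{u, max u v} R :=
  moduleScheme R (LinearMap.ker h)

/-- The projection `𝓝^* → Coker(𝓜^* → 𝓝^*)` in the category of module schemes. -/
def moduleSchemeCokerProj {M N : Type v} [AddCommGroup M] [Module R M] [AddCommGroup N]
    [Module R N] (h : N →ₗ[R] M) : Hom (moduleScheme R N) (moduleSchemeCoker h) :=
  moduleSchemeMap (LinearMap.ker h).subtype

/-- The module scheme closure `𝕄̄ = 𝓓^*` of a functor of modules `𝕄`, where `D = 𝕄^*(R)`. -/
abbrev schemeClosure (M : ModuleFunctor.{u, w} R) : ModuleFunctor.{u, max (u + 1) w} R :=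
  moduleScheme R (Dual M)

/-- The canonical morphism `𝕄 → 𝕄̄`, `x ↦ (φ ↦ φ(x))`. -/
def toClosure (M : ModuleFunctor.{u, w} R) : Hom M (schemeClosure M) where
  app S _ _ :=
    { toFun := fun x =>
        ({ toFun := fun φ => φ.val S x
           map_add' := fun φ ψ => Dual.add_val φ ψ S x
           map_smul' := fun r φ => by
            rw [Dual.smul_val, RingHom.id_apply, Algebra.smul_def] } : Dual M →ₗ[R] S)
      map_add' := fun x y => LinearMap.ext fun φ => map_add (φ.val S) x y
      map_smul' := fun s x => LinearMap.ext fun φ => map_smul (φ.val S) s x }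
  naturality ψ x := LinearMap.ext fun φ => φ.val_map ψ x

/-- The submodule of `M` of all elements on which a subset `F(S)` of every `𝓜^*(S)` vanishes.
The submodule schemes of `𝓜^*` are the `(𝓜/𝓚)^*` with `K ⊆ M` a submodule, and the module scheme
closure of `F` in `𝓜^*`, the smallest one that contains `F`, is the one with this `K`. -/
def vanishing {M : Type v} [AddCommGroup M] [Module R M]
    (F : ∀ (S : Type u) [CommRing S] [Algebra R S], Set (M →ₗ[R] S)) : Submodule R M where
  carrier := {x | ∀ (S : Type u) [CommRing S] [Algebra R S], ∀ f ∈ F S, f x = 0}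
  add_mem' hx hy S _ _ f hf := by rw [map_add, hx S f hf, hy S f hf, add_zero]
  zero_mem' S _ _ f _ := map_zero f
  smul_mem' r x hx S _ _ f hf := by rw [map_smul, hx S f hf, smul_zero]

/-! ## Symmetric powers -/

/-- The linear map `x₁ ⋯ xₙ ↦ g(x₁, …, xₙ)` on the symmetric power induced by a symmetric
multilinear map `g`. -/
noncomputable def symmetricPowerLift {ι : Type u} {S : Type u} [CommRing S] {M : Type v}
    {N : Type w} [AddCommGroup M] [Module S M] [AddCommGroup N] [Module S N]
    (g : MultilinearMap S (fun _ : ι => M) N)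
    (hg : ∀ (e : Equiv.Perm ι) (x : ι → M), (g fun i => x (e i)) = g x) :
    SymmetricPower S ι M →ₗ[S] N where
  toFun := AddCon.lift (addConGen (SymmetricPower.Rel S ι M))
    (PiTensorProduct.lift g).toAddMonoidHom (AddCon.addConGen_le.2 fun x y hxy => by
      cases hxy with
      | perm e f =>
        refine (AddCon.ker_rel _).2 ?_
        change PiTensorProduct.lift g (PiTensorProduct.tprod S f) =
          PiTensorProduct.lift g (PiTensorProduct.tprod S fun i => f (e i))
        rw [PiTensorProduct.lift.tprod, PiTensorProduct.lift.tprod, hg])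
  map_add' := map_add _
  map_smul' s x := AddCon.induction_on x fun y => (PiTensorProduct.lift g).map_smul s y

theorem symmetricPowerLift_tprod {ι : Type u} {S : Type u} [CommRing S] {M : Type v}
    {N : Type w} [AddCommGroup M] [Module S M] [AddCommGroup N] [Module S N]
    (g : MultilinearMap S (fun _ : ι => M) N)
    (hg : ∀ (e : Equiv.Perm ι) (x : ι → M), (g fun i => x (e i)) = g x) (x : ι → M) :
    symmetricPowerLift g hg (SymmetricPower.tprod S x) = g x :=
  PiTensorProduct.lift.tprod (φ := g) x

/-- The map `Sⁿ_S(M) → Sⁿ_T(N)`, `x₁ ⋯ xₙ ↦ h(x₁) ⋯ h(xₙ)`, induced by a `φ`-semilinear map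
`h : M → N`. -/
noncomputable def symmetricPowerMap (ι : Type u) {S T : Type u} [CommRing S] [CommRing T]
    {φ : S →+* T} {M N : Type w} [AddCommGroup M] [Module S M] [AddCommGroup N]
    [Module T N] (h : M →ₛₗ[φ] N) :
    SymmetricPower S ι M →ₛₗ[φ] SymmetricPower T ι N :=
  letI : Module S (SymmetricPower T ι N) := Module.compHom _ φ
  let g : MultilinearMap S (fun _ : ι => M) (SymmetricPower T ι N) :=
    { toFun := fun x => SymmetricPower.tprod T fun i => h (x i)
      map_update_add' := fun x i a b => by
        have key : ∀ c : M, (fun j => h (Function.update x i c j)) =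
            Function.update (fun j => h (x j)) i (h c) := fun c => by
          funext j; by_cases hj : j = i
          · subst hj; simp
          · simp [hj]
        simp only [key, map_add, MultilinearMap.map_update_add]
      map_update_smul' := fun x i s a => by
        have key : ∀ c : M, (fun j => h (Function.update x i c j)) =
            Function.update (fun j => h (x j)) i (h c) := fun c => by
          funext j; by_cases hj : j = i
          · subst hj; simp
          · simp [hj]
        simp only [key, map_smulₛₗ, MultilinearMap.map_update_smul]
        rfl }
  let L : SymmetricPower S ι M →ₗ[S] SymmetricPower T ι N :=
    symmetricPowerLift g fun e x => SymmetricPower.tprod_equiv e fun i => h (x i)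
  { toFun := L
    map_add' := map_add L
    map_smul' := fun s x => map_smul L s x }

theorem symmetricPowerMap_tprod (ι : Type u) {S T : Type u} [CommRing S] [CommRing T]
    {φ : S →+* T} {M N : Type w} [AddCommGroup M] [Module S M] [AddCommGroup N]
    [Module T N] (h : M →ₛₗ[φ] N) (x : ι → M) :
    symmetricPowerMap ι h (SymmetricPower.tprod S x) = SymmetricPower.tprod T fun i => h (x i) := by
  let : Module S (SymmetricPower T ι N) := Module.compHom _ φ
  exact symmetricPowerLift_tprod (S := S) (N := SymmetricPower T ι N) _
    (fun e x => SymmetricPower.tprod_equiv e fun i => h (x i)) x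

theorem symmetricPower_induction {ι : Type u} {S : Type u} [CommRing S] {M : Type w}
    [AddCommGroup M] [Module S M] {p : SymmetricPower S ι M → Prop}
    (tprod : ∀ x : ι → M, p (SymmetricPower.tprod S x))
    (add : ∀ x y, p x → p y → p (x + y)) (smul : ∀ (s : S) x, p x → p (s • x))
    (z : SymmetricPower S ι M) : p z := by
  have hz : z ∈ Submodule.span S (Set.range (SymmetricPower.tprod S (ι := ι) (M := M))) := by
    rw [SymmetricPower.span_tprod_eq_top]; trivial
  induction hz using Submodule.span_induction with
  | mem x hx => obtain ⟨y, rfl⟩ := hx; exact tprod y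
  | zero => simpa using smul 0 (SymmetricPower.tprod S (ι := ι) (M := M) fun _ => 0) (tprod _)
  | add x y _ _ hx hy => exact add x y hx hy
  | smul s x _ hx => exact smul s x hx

/-- The index set `{0, …, n-1}`, in the universe of `R`. -/
abbrev Idx (n : ℕ) : Type u := ULift.{u} (Fin n)

/-- The `n`-th symmetric power `Sⁿ𝕄` of a functor of modules: `(Sⁿ𝕄)(S) = Sⁿ_S(𝕄(S))`. -/
noncomputable def symPow (n : ℕ) (M : ModuleFunctor.{u, w} R) :
    ModuleFunctor.{u, max u w} R where
  obj S _ _ := SymmetricPower S (Idx.{u} n) (M.obj S)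
  addCommGroup _ _ _ := inferInstance
  module _ _ _ := inferInstance
  map φ := symmetricPowerMap (Idx.{u} n) (M.map φ)
  map_id S _ _ x := by
    induction x using symmetricPower_induction with
    | tprod x => simp only [symmetricPowerMap_tprod, M.map_id]
    | add x y hx hy => rw [map_add, hx, hy]
    | smul s x hx => rw [map_smulₛₗ, hx]; rfl
  map_comp φ ψ x := by
    induction x using symmetricPower_induction with
    | tprod x => simp only [symmetricPowerMap_tprod, M.map_comp]
    | add x y hx hy => simp only [map_add, hx, hy]
    | smul s x hx => simp only [map_smulₛₗ, hx]; rfl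

/-- The product `x₁ ⋯ xₙ ∈ Sⁿ_S(𝕄(S))` of elements of `𝕄(S)`. -/
noncomputable def symProd {n : ℕ} (M : ModuleFunctor.{u, w} R) (S : Type u) [CommRing S]
    [Algebra R S] (x : Fin n → M.obj S) : (symPow n M).obj S :=
  SymmetricPower.tprod S (ι := Idx.{u} n) fun i => x i.down

end ModuleFunctor

/-! ## The commutative bialgebra scheme of a cocommutative bialgebra -/

namespace FormalMonoid

open ModuleFunctor

variable (R : Type u) [CommRing R] (A : Type u) [Ring A] [Bialgebra R A]

/-- `𝓐^*(S) = Hom_R(A, S)` as an `S`-algebra: its product is the convolution product, dual to the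
coproduct of `A`. -/
abbrev Fun (S : Type u) [CommRing S] [Algebra R S] : Type u := WithConv (A →ₗ[R] S)

/-- The counit `e : 𝓐^* → 𝓡`, `f ↦ f(1)`, dual to the unit `R → A`. -/
noncomputable def counit (S : Type u) [CommRing S] [Algebra R S] : Fun R A S →ₐ[S] S where
  toFun f := f.ofConv 1
  map_one' := by simp [LinearMap.convOne_def]
  map_mul' f g := by
    simp [LinearMap.convMul_def, Bialgebra.comul_one, Algebra.TensorProduct.one_def]
  map_zero' := rfl
  map_add' _ _ := rfl
  commutes' s := by
    change s • algebraMap R S (Coalgebra.counit (R := R) (1 : A)) = s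
    simp

variable [Coalgebra.IsCocomm R A]

/-- The ideal `𝓘^*(S) = Ker(e) ⊆ 𝓐^*(S)`. -/
noncomputable def augIdeal (S : Type u) [CommRing S] [Algebra R S] : Ideal (Fun R A S) :=
  RingHom.ker (counit R A S)

/-- The submodule `K_n ⊆ A` cutting out `𝓘^{*n}`: the elements on which all products
`f₁ ⋯ fₙ` with `fᵢ ∈ 𝓘^*(S)`, for all `S`, vanish. -/
noncomputable def powVanishing (n : ℕ) : Submodule R A :=
  vanishing fun S _ _ => {f : A →ₗ[R] S | WithConv.toConv f ∈ augIdeal R A S ^ n}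

theorem powVanishing_le_succ (n : ℕ) : powVanishing R A n ≤ powVanishing R A (n + 1) :=
  fun _ hx S _ _ f hf => hx S f (Ideal.pow_le_pow_right n.le_succ hf)

/-- The `R`-module `Iⁿ` whose module scheme is `𝓘^{*n}`. -/
abbrev PowModule (n : ℕ) : Type u := A ⧸ powVanishing R A n

/-- The ideal scheme `𝓘^{*n}`: the module scheme closure in `𝓐^*` of the subfunctor
`S ↦ 𝓘^*(S)ⁿ`. -/
noncomputable abbrev powScheme (n : ℕ) : ModuleFunctor.{u, u} R := moduleScheme R (PowModule R A n)

/-- `f ∈ 𝓘^{*n}(S)`, for `f ∈ 𝓐^*(S)`. -/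
def MemPow {R : Type u} [CommRing R] {A : Type u} [Ring A] [Bialgebra R A]
    [Coalgebra.IsCocomm R A] (n : ℕ) {S : Type u} [CommRing S] [Algebra R S] (f : A →ₗ[R] S) : Prop :=
  ∀ x ∈ powVanishing R A n, f x = 0

/-- The linear map `Iⁿ → Iⁿ⁺¹` dual to the inclusion `𝓘^{*n+1} → 𝓘^{*n}`. -/
noncomputable def powStep (n : ℕ) : PowModule R A n →ₗ[R] PowModule R A (n + 1) :=
  Submodule.factor (powVanishing_le_succ R A n)

/-- The quotient `𝓘^{*n}/𝓘^{*n+1}` in the category of module schemes. -/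
noncomputable abbrev grScheme (n : ℕ) : ModuleFunctor.{u, u} R := moduleSchemeCoker (powStep R A n)

/-- An element of `𝓘^*(S)ⁿ`, as an element of `𝓘^{*n}(S)`. -/
noncomputable def powMk (n : ℕ) {S : Type u} [CommRing S] [Algebra R S] (f : Fun R A S)
    (hf : f ∈ augIdeal R A S ^ n) : (powScheme R A n).obj S :=
  (powVanishing R A n).liftQ f.ofConv fun _ hx => hx S f.ofConv hf

/-- The class in `(𝓘^{*n}/𝓘^{*n+1})(S)` of an element of `𝓘^*(S)ⁿ`. -/
noncomputable def grMk (n : ℕ) {S : Type u} [CommRing S] [Algebra R S] (f : Fun R A S)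
    (hf : f ∈ augIdeal R A S ^ n) : (grScheme R A n).obj S :=
  (moduleSchemeCokerProj (powStep R A n)).app S (powMk R A n f hf)

/-- `Spec 𝓐^*` is a flat infinitesimal formal monoid. -/
structure IsFlatInfinitesimal : Prop where
  /-- `A` is a flat `R`-module. -/
  flat : Module.Flat R A
  /-- `𝓐^* = lim 𝓐^*/𝓘^{*i}`, where `𝓐^*/𝓘^{*i}` is the quotient in the category of module
  schemes, that is, the module scheme of `Ker(A → Iⁱ) = K_i`. -/
  isLimit : ∀ (S : Type u) [CommRing S] [Algebra R S]
    (g : ∀ i : ℕ, powVanishing R A i →ₗ[R] S),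
    (∀ i, g (i + 1) ∘ₗ Submodule.inclusion (powVanishing_le_succ R A i) = g i) →
    ∃! f : A →ₗ[R] S, ∀ i, f ∘ₗ (powVanishing R A i).subtype = g i
  /-- `(𝓘^{*n})_{|S} = (𝓘^*_{|S})ⁿ` for all base changes `R → S`, where `𝓐^*_{|S}` is the bialgebra
  scheme of the `S`-bialgebra `S ⊗ A`; an element `f` of `𝓐^*(T) = Hom_R(A, T)` is the element
  `s ⊗ a ↦ s f(a)` of `𝓐^*_{|S}(T) = Hom_S(S ⊗ A, T)`. -/
  baseChange : ∀ (n : ℕ) (S : Type u) [CommRing S] [Algebra R S]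
    (T : Type u) [CommRing T] [Algebra R T] [Algebra S T] [IsScalarTower R S T]
    (f : A →ₗ[R] T), MemPow n f ↔ MemPow (R := S) (A := S ⊗[R] A) n (f.liftBaseChange S)

variable {R A} in
theorem prod_mem_augIdeal_pow {n : ℕ} {S : Type u} [CommRing S] [Algebra R S]
    (f : Fin n → Fun R A S) (hf : ∀ i, f i ∈ augIdeal R A S) :
    ∏ i, f i ∈ augIdeal R A S ^ n := by
  simpa using Ideal.prod_mem_prod (s := Finset.univ) (I := fun _ : Fin n => augIdeal R A S)
    fun i _ => hf i

/-- The morphism `m` from the module scheme closure of `Sⁿ(𝓘^*/𝓘^{*2})` to `𝓘^{*n}/𝓘^{*n+1}` is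
the one induced by multiplication: it maps (the image in the closure of) the symmetric product
`[f₁] ⋯ [fₙ]` to `[f₁ ⋯ fₙ]`, for all `f₁, …, fₙ ∈ 𝓘^*(S)`. -/
def IsMultiplication (n : ℕ)
    (m : Hom (schemeClosure (symPow n (grScheme R A 1))) (grScheme R A n)) : Prop :=
  ∀ (S : Type u) [CommRing S] [Algebra R S] (f : Fin n → Fun R A S)
    (hf : ∀ i, f i ∈ augIdeal R A S),
    m.app S ((toClosure (symPow n (grScheme R A 1))).app S
      (symProd (grScheme R A 1) S fun i => grMk R A 1 (f i) (by simpa using hf i))) =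
    grMk R A n (∏ i, f i) (prod_mem_augIdeal_pow f hf)

end FormalMonoid

/-! Write `K_n` for `powVanishing R A n`, `I = A / R = A / K_1` and `P = K_2 / K_1`, the module of
primitive elements. The quotient `𝓘^{*n}/𝓘^{*n+1}` is the module scheme of `K_{n+1}/K_n`. The
theorem is dual to the statement that `K_{n+1}/K_n` and the symmetric tensors in `P^{⊗n}` are the
same submodule of `I^{⊗n}`.

Linear forms on `Sⁿ(𝓟^*)` are symmetric tensors in `P^{⊗n}`: such a form is determined by its value
at the universal linear maps from `P` to the algebra `⨂ (R ⊕ P)` (`tensorEval_dualTensor`). On the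
other side, the iterated reduced comultiplication `A → I^{⊗n}` computes products of `n` elements of
`𝓘^*`. For `n ≥ 1` its kernel is therefore `K_n` (`mem_powVanishing_succ_iff`), and `K_{n+1}/K_n`
embeds in `I^{⊗n}`.

The base change condition, applied to the algebras `R ⊕ M`, makes `P` a pure submodule of the flat
module `I` (`lTensor_primitive_injective`), so `P^{⊗n}` embeds in `I^{⊗n}`. Coassociativity puts the
image of `K_{n+1}` into `P^{⊗n}` (`exists_primIncl_comp_eq`), and cocommutativity makes it
symmetric.

Conversely, let `z` be a symmetric tensor and `μ(z)` its image under the multiplication of `A`.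
Primitive elements act on `𝓐^*` by derivations, so `μ(z)` is sent to `n! z` (`iterComul_primMul`).
Hence `μ(z)` lies in `K_n` modulo `n!`, and base change to `R / n!` gives `μ(z) = k + n! b` with `k
∈ K_n`. As `I^{⊗n}` is torsion-free over `ℤ`, `b` is sent to `z` (`exists_iterComul_eq`). -/

namespace ModuleFunctor

/-! ### Evaluation of tensors on families of linear forms. -/

section TensorEval

variable {R : Type*} [CommRing R] {ι : Type*} [Fintype ι] {Y : Type*} [AddCommGroup Y] [Module R Y]
  {S : Type*} [CommRing S] [Algebra R S]

/-- The linear form `y₁ ⊗ ⋯ ⊗ yₙ ↦ f₁(y₁) ⋯ fₙ(yₙ)`. -/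
noncomputable def tensorEval (f : ι → Y →ₗ[R] S) : (⨂[R] _ : ι, Y) →ₗ[R] S :=
  PiTensorProduct.lift ((MultilinearMap.mkPiAlgebra R ι S).compLinearMap f)

@[simp]
theorem tensorEval_tprod (f : ι → Y →ₗ[R] S) (y : ι → Y) :
    tensorEval f (PiTensorProduct.tprod R y) = ∏ i, f i (y i) := by
  simp [tensorEval]

omit [Fintype ι] in
theorem linearMap_apply_eq_of_tprod {E : Type*} [AddCommGroup E] [Module R E]
    {f g : (⨂[R] _ : ι, Y) →ₗ[R] E}
    (h : ∀ y : ι → Y, f (PiTensorProduct.tprod R y) = g (PiTensorProduct.tprod R y))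
    (z : ⨂[R] _ : ι, Y) : f z = g z :=
  LinearMap.congr_fun (PiTensorProduct.ext (MultilinearMap.ext h)) z

theorem tensorEval_map {X : Type*} [AddCommGroup X] [Module R X] (f : ι → X →ₗ[R] S)
    (g : Y →ₗ[R] X) (z : ⨂[R] _ : ι, Y) :
    tensorEval f (PiTensorProduct.map (fun _ => g) z) = tensorEval (fun i => f i ∘ₗ g) z :=
  linearMap_apply_eq_of_tprod (f := tensorEval f ∘ₗ PiTensorProduct.map (fun _ => g))
    (fun y => by simp) z

theorem tensorEval_reindex (f : ι → Y →ₗ[R] S) (e : Equiv.Perm ι) (z : ⨂[R] _ : ι, Y) :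
    tensorEval f (PiTensorProduct.reindex R (fun _ => Y) e z) =
      tensorEval (fun i => f (e i)) z :=
  linearMap_apply_eq_of_tprod
    (f := tensorEval f ∘ₗ (PiTensorProduct.reindex R (fun _ => Y) e).toLinearMap)
    (fun y => by
      simp only [LinearMap.comp_apply, LinearEquiv.coe_coe, PiTensorProduct.reindex_tprod,
        tensorEval_tprod]
      exact Fintype.prod_equiv e.symm _ _ (by simp)) z

theorem algHom_tensorEval {T : Type*} [CommRing T] [Algebra R T] (φ : S →ₐ[R] T)
    (f : ι → Y →ₗ[R] S) (z : ⨂[R] _ : ι, Y) :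
    φ (tensorEval f z) = tensorEval (fun i => φ.toLinearMap ∘ₗ f i) z :=
  linearMap_apply_eq_of_tprod (f := φ.toLinearMap ∘ₗ tensorEval f)
    (fun y => by simp) z

end TensorEval

/-! ### Square-zero extensions, the test algebras of the proof. -/

/-- The trivial square-zero extension `S ⊕ M` of a commutative ring by a module. -/
def SqZero (S : Type*) (M : Type*) : Type _ := TrivSqZeroExt S M

namespace SqZero

variable {R S M : Type*} [CommRing R] [CommRing S] [Algebra R S] [AddCommGroup M] [Module S M]

noncomputable instance : CommRing (SqZero S M) :=
  -- `TrivSqZeroExt` wants a bimodule; the right action is the left one, and it stays local to this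
  -- instance.
  letI : Module Sᵐᵒᵖ M := Module.compHom M ((RingHom.id S).fromOpposite mul_comm)
  haveI : IsCentralScalar S M := ⟨fun _ _ => rfl⟩
  inferInstanceAs (CommRing (TrivSqZeroExt S M))

/-- The element `(s, m)` of `S ⊕ M`. -/
def mk (s : S) (m : M) : SqZero S M := (s, m)

theorem mk_add (s t : S) (m n : M) : mk s m + mk t n = mk (s + t) (m + n) := rfl

theorem mk_mul (s t : S) (m n : M) : mk s m * mk t n = mk (s * t) (s • n + t • m) := rfl

noncomputable instance : Algebra R (SqZero S M) :=
  RingHom.toAlgebra <| RingHom.comp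
    { toFun := fun s : S => mk s (0 : M)
      map_one' := rfl
      map_mul' := fun s t => by rw [mk_mul, smul_zero, smul_zero, add_zero]
      map_zero' := rfl
      map_add' := fun s t => by rw [mk_add, add_zero] } (algebraMap R S)

theorem algebraMap_eq (r : R) : algebraMap R (SqZero S M) r = mk (algebraMap R S r) 0 := rfl

theorem smul_mk [Module R M] [IsScalarTower R S M] (r : R) (s : S) (m : M) :
    r • mk s m = mk (r • s) (r • m) := by
  rw [Algebra.smul_def, algebraMap_eq, mk_mul, smul_zero, add_zero, algebraMap_smul,
    Algebra.smul_def]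

instance : IsScalarTower R S (SqZero S M) := IsScalarTower.of_algebraMap_eq fun _ => rfl

variable (S M) in
/-- The inclusion `M → S ⊕ M`. -/
noncomputable def inr : M →ₗ[S] SqZero S M where
  toFun := mk 0
  map_add' m n := by rw [mk_add, add_zero]
  map_smul' s m := by rw [smul_mk, smul_zero, RingHom.id_apply]

variable (S M) in
/-- The projection `S ⊕ M → M`. -/
noncomputable def snd : SqZero S M →ₗ[S] M where
  toFun := Prod.snd
  map_add' _ _ := rfl
  map_smul' s m := by
    obtain ⟨t, n⟩ := m
    exact congrArg Prod.snd (smul_mk s t n)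

@[simp]
theorem snd_inr (m : M) : snd S M (inr S M m) = m := rfl

theorem inr_injective : Function.Injective (inr S M) :=
  Function.LeftInverse.injective snd_inr

variable {N : Type*} [AddCommGroup N] [Module R N] 

/-- The algebra map `R ⊕ N → S ⊕ M` induced by a linear map `N → M`. -/
noncomputable def map [Module R M] [IsScalarTower R S M] (f : N →ₗ[R] M) :
    SqZero R N →ₐ[R] SqZero S M where
  toFun x := mk (algebraMap R S x.1) (f x.2)
  map_one' := congrArg₂ mk (map_one _) (map_zero f)
  map_zero' := congrArg₂ mk (map_zero _) (map_zero f)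
  map_add' x y := by
    obtain ⟨a, m⟩ := x
    obtain ⟨b, n⟩ := y
    exact congrArg₂ mk (map_add _ a b) (map_add f m n)
  map_mul' x y := by
    obtain ⟨a, m⟩ := x
    obtain ⟨b, n⟩ := y
    change mk (algebraMap R S (a * b)) (f (a • n + b • m)) = _
    rw [mk_mul, map_mul, map_add, map_smul, map_smul, algebraMap_smul, algebraMap_smul]
  commutes' r := congrArg (mk (algebraMap R S r)) (map_zero f)

@[simp]
theorem map_inr [Module R M] [IsScalarTower R S M] (f : N →ₗ[R] M) (n : N) :
    map (S := S) f (inr R N n) = inr S M (f n) :=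
  congrArg₂ mk (map_zero _) rfl

@[simp]
theorem snd_map [Module R M] [IsScalarTower R S M] (f : N →ₗ[R] M) (x : SqZero R N) :
    snd S M (map (S := S) f x) = f (snd R N x) := rfl

end SqZero

/-! ### The universal algebra that detects tensors. -/

section Yoneda

variable {R : Type u} [CommRing R] {ι : Type w} [Fintype ι] [DecidableEq ι]
  {Y : Type v} [AddCommGroup Y] [Module R Y]

variable (R ι Y) in
/-- The universal algebra with linear maps `Y → TensorAlg R ι Y` of square zero image, one for
each element of `ι`. -/
abbrev TensorAlg : Type _ := ⨂[R] _ : ι, SqZero R Y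

variable (R Y) in
/-- The universal linear maps `Y → TensorAlg R ι Y`. -/
noncomputable def TensorAlg.univ (i : ι) : Y →ₗ[R] TensorAlg R ι Y :=
  (PiTensorProduct.singleAlgHom (R := R) (A := fun _ : ι => SqZero R Y) i).toLinearMap ∘ₗ
    SqZero.inr R Y

/-- The projection to the component of degree `(1, …, 1)`. -/
noncomputable def TensorAlg.proj : TensorAlg R ι Y →ₗ[R] ⨂[R] _ : ι, Y :=
  PiTensorProduct.map fun _ => SqZero.snd R Y

theorem TensorAlg.prod_singleAlgHom (x : ι → SqZero R Y) :
    ∏ i, PiTensorProduct.singleAlgHom (R := R) (A := fun _ : ι => SqZero R Y) i (x i) =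
      PiTensorProduct.tprod R x := by
  simp only [PiTensorProduct.singleAlgHom_apply, MonoidHom.mulSingle_apply]
  rw [← PiTensorProduct.tprod_prod, Finset.univ_prod_mulSingle]

/-- On a pure tensor, the product of the universal maps is the pure tensor of the elements `(0, yᵢ)`
of `R ⊕ Y`. Evaluation at the universal family therefore loses no information. -/
theorem TensorAlg.proj_tensorEval_univ (z : ⨂[R] _ : ι, Y) :
    TensorAlg.proj (tensorEval (TensorAlg.univ R Y) z) = z :=
  linearMap_apply_eq_of_tprod (f := TensorAlg.proj ∘ₗ tensorEval (TensorAlg.univ R Y))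
    (g := LinearMap.id) (fun y => by
      simp [TensorAlg.univ, TensorAlg.prod_singleAlgHom, TensorAlg.proj,
        -PiTensorProduct.singleAlgHom_apply]) z

/-- A tensor is zero if all products of linear maps to commutative algebras vanish on it. -/
theorem eq_zero_of_tensorEval {Y : Type u} [AddCommGroup Y] [Module R Y] {ι : Type} [Fintype ι] 
    (z : ⨂[R] _ : ι, Y)
    (h : ∀ (S : Type u) [CommRing S] [Algebra R S] (f : ι → Y →ₗ[R] S), tensorEval f z = 0) :
    z = 0 := by
  classical
  rw [← TensorAlg.proj_tensorEval_univ z, h, map_zero]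

variable {S : Type*} [CommRing S] [Algebra R S]

/-- The algebra map from the universal algebra over `R` to the one of the `S`-module `S` induced
by linear maps `Y → S`. -/
noncomputable def TensorAlg.spec (f : ι → Y →ₗ[R] S) : TensorAlg R ι Y →ₐ[R] TensorAlg S ι S :=
  PiTensorProduct.liftAlgHom
    ((MultilinearMap.mkPiAlgebra R ι (TensorAlg S ι S)).compLinearMap fun i =>
      (((PiTensorProduct.singleAlgHom (R := S) (A := fun _ : ι => SqZero S S) i).restrictScalars
        R).comp (SqZero.map (f i))).toLinearMap)
    (by simp [-PiTensorProduct.singleAlgHom_apply])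
    (fun x y => by simp [Finset.prod_mul_distrib, -PiTensorProduct.singleAlgHom_apply])

theorem TensorAlg.spec_tprod (f : ι → Y →ₗ[R] S) (x : ι → SqZero R Y) :
    TensorAlg.spec f (PiTensorProduct.tprod R x) =
      PiTensorProduct.tprod S fun i => SqZero.map (f i) (x i) := by
  rw [← TensorAlg.prod_singleAlgHom (R := S)]
  simp [TensorAlg.spec, -PiTensorProduct.singleAlgHom_apply]

/-- The coefficient of `ε₁ ⋯ εₙ`. -/
noncomputable def TensorAlg.coeff : TensorAlg S ι S →ₗ[S] S :=
  tensorEval fun _ => SqZero.snd S S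

theorem TensorAlg.coeff_spec (f : ι → Y →ₗ[R] S) (x : TensorAlg R ι Y) :
    TensorAlg.coeff (TensorAlg.spec f x) = tensorEval f (TensorAlg.proj x) :=
  linearMap_apply_eq_of_tprod
    (f := TensorAlg.coeff.restrictScalars R ∘ₗ (TensorAlg.spec f).toLinearMap)
    (g := tensorEval f ∘ₗ TensorAlg.proj)
    (fun x => by simp [TensorAlg.spec_tprod, TensorAlg.coeff, TensorAlg.proj]) x

end Yoneda
-- Linear forms on `Sⁿ(𝒴^*)` are symmetric tensors.
section SymPow

variable {R : Type u} [CommRing R] {n : ℕ}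

theorem map_symProd (M : ModuleFunctor.{u, w} R) {S T : Type u} [CommRing S] [Algebra R S]
    [CommRing T] [Algebra R T] (φ : S →ₐ[R] T) (x : Fin n → M.obj S) :
    (symPow n M).map φ (symProd M S x) = symProd M T fun i => M.map φ (x i) :=
  symmetricPowerMap_tprod _ _ _

theorem symProd_smul (M : ModuleFunctor.{u, w} R) (S : Type u) [CommRing S] [Algebra R S]
    (c : Fin n → S) (x : Fin n → M.obj S) :
    symProd M S (fun i => c i • x i) = (∏ i, c i) • symProd M S x := by
  refine (MultilinearMap.map_smul_univ (SymmetricPower.tprod S (ι := Idx.{u} n)) (fun i => c i.down)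
    fun i => x i.down).trans ?_
  congr 1
  exact Fintype.prod_equiv Equiv.ulift _ _ fun _ => rfl

theorem Dual.ext_symProd {M : ModuleFunctor.{u, w} R} {φ ψ : Dual (symPow n M)}
    (h : ∀ (S : Type u) [CommRing S] [Algebra R S] (x : Fin n → M.obj S),
      φ.val S (symProd M S x) = ψ.val S (symProd M S x)) : φ = ψ := by
  refine Dual.ext_val fun S _ _ z => ?_
  refine symmetricPower_induction (p := fun z => φ.val S z = ψ.val S z)
    (fun x => h S fun i => x ⟨i⟩) (fun x y hx hy => ?_) (fun s x hx => ?_) z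
  · exact (map_add (φ.val S) x y).trans ((congrArg₂ _ hx hy).trans (map_add (ψ.val S) x y).symm)
  · exact (map_smul (φ.val S) s x).trans ((congrArg _ hx).trans (map_smul (ψ.val S) s x).symm)

variable {Y : Type u} [AddCommGroup Y] [Module R Y]

/-- The tensor in `Y ⊗ ⋯ ⊗ Y` of a linear form on `Sⁿ(𝒴^*)`. -/
noncomputable def dualTensor (n : ℕ) :
    Dual (symPow n (moduleScheme R Y)) →ₗ[R] ⨂[R] _ : Fin n, Y where
  toFun φ := TensorAlg.proj (φ.val (TensorAlg R (Fin n) Y)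
    (symProd (moduleScheme R Y) _ (TensorAlg.univ R Y)))
  map_add' φ ψ := by rw [Dual.add_val, map_add]
  map_smul' r φ := by rw [Dual.smul_val, ← Algebra.smul_def, map_smul, RingHom.id_apply]

/-- The form `φ` is known at the universal family only. Specialization by `f` sends this family to
`(εᵢ fᵢ)` over `S[ε₁, …, εₙ]/(εᵢ²)`, where naturality and multilinearity give `φ` the value `ε₁ ⋯ εₙ
φ(f₁ ⋯ fₙ)`. The coefficient of `ε₁ ⋯ εₙ` is the claim. -/
theorem tensorEval_dualTensor (φ : Dual (symPow n (moduleScheme R Y))) {S : Type u} [CommRing S]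
    [Algebra R S] (f : Fin n → Y →ₗ[R] S) :
    tensorEval f (dualTensor n φ) = φ.val S (symProd (moduleScheme R Y) S f) := by
  -- `C` is `S[ε₁, …, εₙ]/(εᵢ²)`, and `ψ` is its structure map.
  let C := TensorAlg S (Fin n) S
  let ε : Fin n → C := fun i => TensorAlg.univ S S i 1
  let ψ : S →ₐ[R] C := (Algebra.ofId S C).restrictScalars R
  have h₁ : TensorAlg.spec f (φ.val (TensorAlg R (Fin n) Y)
      (symProd (moduleScheme R Y) _ (TensorAlg.univ R Y))) =
      (∏ i, ε i) • ψ (φ.val S (symProd (moduleScheme R Y) S f)) := by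
    let U : Fin n → (moduleScheme R Y).obj (TensorAlg R (Fin n) Y) := TensorAlg.univ R Y
    let F : Fin n → (moduleScheme R Y).obj S := f
    change TensorAlg.spec f (φ.val _ (symProd (moduleScheme R Y) _ U)) =
      (∏ i, ε i) • ψ (φ.val S (symProd (moduleScheme R Y) S F))
    rw [← Dual.val_map, ← Dual.val_map, map_symProd, map_symProd, ← map_smul, ← symProd_smul]
    congr 2
    funext i
    refine LinearMap.ext fun y => ?_
    change TensorAlg.spec f (PiTensorProduct.singleAlgHom (R := R) i (SqZero.inr R Y y)) =
      PiTensorProduct.singleAlgHom (R := S) i (SqZero.inr S S 1) * algebraMap S C (f i y)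
    rw [mul_comm, ← Algebra.smul_def, ← map_smul, ← map_smul, smul_eq_mul, mul_one,
      PiTensorProduct.singleAlgHom_apply, TensorAlg.spec_tprod, PiTensorProduct.singleAlgHom_apply]
    congr 1
    funext j
    by_cases hj : j = i
    · subst hj; simp
    · simp [Pi.mulSingle_eq_of_ne hj]
  have h₂ := congrArg TensorAlg.coeff h₁
  rw [TensorAlg.coeff_spec] at h₂
  refine h₂.trans ?_
  change TensorAlg.coeff ((∏ i, ε i) * algebraMap S C _) = _
  rw [mul_comm, ← Algebra.smul_def, map_smul]
  have h₃ : TensorAlg.coeff (∏ i, ε i) = 1 := by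
    change TensorAlg.coeff (∏ i, PiTensorProduct.singleAlgHom (R := S)
      (A := fun _ : Fin n => SqZero S S) i (SqZero.inr S S 1)) = 1
    rw [TensorAlg.prod_singleAlgHom]
    simp [TensorAlg.coeff]
  rw [h₃, smul_eq_mul, mul_one]

theorem dualTensor_injective :
    Function.Injective (dualTensor (R := R) (Y := Y) n) := fun φ ψ h =>
  Dual.ext_symProd fun _ _ _ f =>
    (tensorEval_dualTensor φ f).symm.trans ((congrArg _ h).trans (tensorEval_dualTensor ψ f))

theorem eq_of_tensorEval {z z' : ⨂[R] _ : Fin n, Y}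
    (h : ∀ (S : Type u) [CommRing S] [Algebra R S] (f : Fin n → Y →ₗ[R] S),
      tensorEval f z = tensorEval f z') : z = z' :=
  sub_eq_zero.1 <| eq_zero_of_tensorEval _ fun _ _ _ f => by rw [map_sub, h, sub_self]

theorem symProd_perm (M : ModuleFunctor.{u, w} R) (S : Type u) [CommRing S] [Algebra R S]
    (e : Equiv.Perm (Fin n)) (x : Fin n → M.obj S) :
    symProd M S (fun i => x (e i)) = symProd M S x :=
  SymmetricPower.tprod_equiv (ι := Idx.{u} n) (Equiv.ulift.trans (e.trans Equiv.ulift.symm))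
    fun i => x i.down

/-- Factors commute in a symmetric power, and tensors are separated by their evaluations. -/
theorem reindex_dualTensor (φ : Dual (symPow n (moduleScheme R Y))) (e : Equiv.Perm (Fin n)) :
    PiTensorProduct.reindex R (fun _ => Y) e (dualTensor n φ) = dualTensor n φ :=
  eq_of_tensorEval fun _ _ _ f => by
    rw [tensorEval_reindex, tensorEval_dualTensor, tensorEval_dualTensor]
    exact congrArg _ (symProd_perm (moduleScheme R Y) _ e f)

theorem prod_update_apply {ι : Type*} [Fintype ι] [DecidableEq ι] {S : Type*} [CommRing S]
    [Algebra R S] (f : ι → Y →ₗ[R] S) (i : ι) (c : Y →ₗ[R] S) (y : ι → Y) :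
    ∏ j, Function.update f i c j (y j) = c (y i) * ∏ j ∈ {i}ᶜ, f j (y j) := by
  rw [Fintype.prod_eq_mul_prod_compl i, Function.update_self]
  congr 1
  refine Finset.prod_congr rfl fun j hj => ?_
  rw [Function.update_of_ne (by simpa using hj)]

/-- The `S`-multilinear map `(f₁, …, fₙ) ↦ (f₁ ⊗ ⋯ ⊗ fₙ)(z)`. -/
noncomputable def tensorEvalMultilinear {ι : Type*} [Fintype ι] (S : Type*) [CommRing S]
    [Algebra R S] (z : ⨂[R] _ : ι, Y) : MultilinearMap S (fun _ : ι => Y →ₗ[R] S) S where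
  toFun f := tensorEval f z
  map_update_add' {_} f i a b := by
    classical
    refine linearMap_apply_eq_of_tprod (g := tensorEval (Function.update f i a) +
      tensorEval (Function.update f i b)) (fun y => ?_) z
    simp [prod_update_apply, add_mul]
  map_update_smul' {_} f i c a := by
    classical
    refine linearMap_apply_eq_of_tprod (g := c • tensorEval (Function.update f i a))
       (fun y => ?_) z
    simp [prod_update_apply, mul_assoc]

theorem tensorEvalMultilinear_perm (z : ⨂[R] _ : Fin n, Y)
    (hz : ∀ e : Equiv.Perm (Fin n), PiTensorProduct.reindex R (fun _ => Y) e z = z)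
    (S : Type*) [CommRing S] [Algebra R S] (e : Equiv.Perm (Idx.{u} n)) (x : Idx.{u} n → Y →ₗ[R] S) :
    ((tensorEvalMultilinear S z).domDomCongr Equiv.ulift.symm fun i => x (e i)) =
      (tensorEvalMultilinear S z).domDomCongr Equiv.ulift.symm x := by
  have := tensorEval_reindex (fun i => x ⟨i⟩) (Equiv.ulift.symm.trans (e.trans Equiv.ulift)) z
  rw [hz] at this
  exact this.symm

/-- The linear form on `Sⁿ(𝒴^*)` of a symmetric tensor. -/
noncomputable def dualOfSymmetric (z : ⨂[R] _ : Fin n, Y)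
    (hz : ∀ e : Equiv.Perm (Fin n), PiTensorProduct.reindex R (fun _ => Y) e z = z) :
    Dual (symPow n (moduleScheme R Y)) :=
  let g (S : Type u) [CommRing S] [Algebra R S] :
      SymmetricPower S (Idx.{u} n) ((moduleScheme R Y).obj S) →ₗ[S] S :=
    symmetricPowerLift ((tensorEvalMultilinear S z).domDomCongr Equiv.ulift.symm)
      (tensorEvalMultilinear_perm z hz S)
  have hg (S : Type u) [CommRing S] [Algebra R S] 
      (x : Idx.{u} n → (moduleScheme R Y).obj S) : g S (SymmetricPower.tprod S x) = tensorEval (fun i => x ⟨i⟩) z :=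
    symmetricPowerLift_tprod _ _ x
  { app := fun S _ _ => g S
    naturality := fun {S T} _ _ _ _ ψ x => by
      refine symmetricPower_induction (p := fun x => g T (symmetricPowerMap (Idx.{u} n)
        ((moduleScheme R Y).map ψ) x) = ψ (g S x))
        (fun x => ?_) (fun x y hx hy => ?_) (fun s x hx => ?_) x
      · refine (congrArg _ (symmetricPowerMap_tprod _ _ _)).trans ?_
        refine (hg T _).trans (.trans ?_ (congrArg ψ (hg S x)).symm)
        exact (algHom_tensorEval ψ (fun i => x ⟨i⟩) z).symm
      · rw [map_add, map_add, hx, hy, map_add, map_add]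
      · rw [map_smulₛₗ, map_smul, hx, map_smul]
        exact (map_mul ψ s (g S x)).symm }

theorem dualOfSymmetric_symProd (z : ⨂[R] _ : Fin n, Y)
    (hz : ∀ e : Equiv.Perm (Fin n), PiTensorProduct.reindex R (fun _ => Y) e z = z)
    (S : Type u) [CommRing S] [Algebra R S] (f : Fin n → Y →ₗ[R] S) :
    (dualOfSymmetric z hz).val S (symProd (moduleScheme R Y) S f) = tensorEval f z :=
  symmetricPowerLift_tprod (M := (moduleScheme R Y).obj S)
    ((tensorEvalMultilinear S z).domDomCongr Equiv.ulift.symm)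
    (tensorEvalMultilinear_perm z hz S) _

theorem dualTensor_dualOfSymmetric (z : ⨂[R] _ : Fin n, Y)
    (hz : ∀ e : Equiv.Perm (Fin n), PiTensorProduct.reindex R (fun _ => Y) e z = z) :
    dualTensor n (dualOfSymmetric z hz) = z :=
  eq_of_tensorEval fun S _ _ f => by rw [tensorEval_dualTensor, dualOfSymmetric_symProd]

end SymPow

/-! ### Morphisms of module schemes are dual to linear maps. -/

section ModuleSchemeHom

variable {R : Type u} [CommRing R]

/-- The morphism `𝓜^* → 𝓝^*` dual to a linear map `N → M`, for modules in different universes. -/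
def dualHom {M : Type v} {N : Type w} [AddCommGroup M] [Module R M] [AddCommGroup N] [Module R N]
    (h : N →ₗ[R] M) : Hom (moduleScheme R M) (moduleScheme R N) where
  app S _ _ :=
    { toFun := fun (f : M →ₗ[R] S) => f ∘ₗ h
      map_add' := fun _ _ => rfl
      map_smul' := fun _ _ => rfl }
  naturality _ _ := rfl

/-- Every morphism between the module schemes of small modules is dual to a linear map. -/
theorem exists_eq_dualHom {M : Type u} {N : Type w} [AddCommGroup M] [Module R M] [AddCommGroup N]
    [Module R N] (m : Hom (moduleScheme R M) (moduleScheme R N)) :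
    ∃ h : N →ₗ[R] M, m = dualHom h := by
  -- Yoneda: the inclusion `M → R ⊕ M` is the universal element, and the linear map is the
  -- `M`-component of its image under `m`.
  refine ⟨SqZero.snd R M ∘ₗ m.app (SqZero R M) (SqZero.inr R M), ?_⟩
  refine Hom.ext ?_
  funext S _ _
  refine LinearMap.ext fun F => LinearMap.ext fun (x : N) => ?_
  let f : M →ₗ[R] S := F
  let U : (moduleScheme R M).obj (SqZero R M) := SqZero.inr R M
  have h₁ := m.naturality (SqZero.map (S := S) f) U
  let ψ : S →ₐ[R] SqZero S S := (Algebra.ofId S (SqZero S S)).restrictScalars R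
  -- Over the dual numbers `S ⊕ Sε`, the universal element specializes to `ε f`; linearity over this
  -- ring turns its image into `ε m(f)`.
  have h₂ : (moduleScheme R M).map (SqZero.map (S := S) f) U =
      SqZero.inr S S 1 • (moduleScheme R M).map ψ F := by
    refine LinearMap.ext fun y => ?_
    change SqZero.map (S := S) f (SqZero.inr R M y) = SqZero.inr S S 1 * algebraMap S _ (f y)
    rw [SqZero.map_inr, mul_comm, ← Algebra.smul_def, ← map_smul, smul_eq_mul, mul_one]
  rw [h₂, map_smul, m.naturality] at h₁
  have h₃ := congrArg (SqZero.snd S S) (LinearMap.congr_fun h₁ x)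
  let mF : N →ₗ[R] S := m.app S F
  let mU : N →ₗ[R] SqZero R M := m.app (SqZero R M) U
  change SqZero.snd S S (SqZero.inr S S 1 * algebraMap S _ (mF x)) = f (SqZero.snd R M (mU x)) at h₃
  rw [mul_comm, ← Algebra.smul_def, ← map_smul, smul_eq_mul, mul_one, SqZero.snd_inr] at h₃
  exact h₃

end ModuleSchemeHom
-- Purity from universal exactness and flatness.
section Purity

variable {R : Type u} [CommRing R] {X Y : Type u} [AddCommGroup X] [Module R X] [AddCommGroup Y]
  [Module R Y]

/-- If `P = Ker d` and `M ⊗ P → M ⊗ X → M ⊗ Y` is exact for all modules `M`, and `Y` is flat, then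
`P` is a pure submodule of `X`. -/
theorem lTensor_subtype_injective_of_exact [Module.Flat R Y] {P : Submodule R X} (d : X →ₗ[R] Y)
    (hP : P = LinearMap.ker d)
    (hd : ∀ (M : Type u) [AddCommGroup M] [Module R M] (x : M ⊗[R] X), d.lTensor M x = 0 →
      x ∈ LinearMap.range (P.subtype.lTensor M))
    (M : Type u) [AddCommGroup M] [Module R M] :
    Function.Injective (P.subtype.lTensor M) := by
  rw [injective_iff_map_eq_zero]
  intro x hx
  -- Diagram chase in a free presentation `0 → N → F → M → 0`: the lift `y ∈ F ⊗ P` of `x` is shown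
  -- to come from `N ⊗ P`.
  obtain ⟨F, _, _, _, p, hp⟩ : ∃ (F : Type u) (_ : AddCommGroup F) (_ : Module R F)
      (_ : Module.Flat R F) (p : F →ₗ[R] M), Function.Surjective p :=
    ⟨M →₀ R, inferInstance, inferInstance, inferInstance, Finsupp.linearCombination R id,
      Finsupp.linearCombination_id_surjective R M⟩
  obtain ⟨y, rfl⟩ := LinearMap.rTensor_surjective P hp x
  have h₁ : p.rTensor X (P.subtype.lTensor _ y) = 0 := by
    rw [← hx, ← LinearMap.comp_apply, ← LinearMap.comp_apply, LinearMap.rTensor_comp_lTensor,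
      LinearMap.lTensor_comp_rTensor]
  let N := LinearMap.ker p
  have hex : Function.Exact N.subtype p := LinearMap.exact_subtype_ker_map p
  obtain ⟨w, hw⟩ := (rTensor_exact X hex hp _).1 h₁
  have h₂ : N.subtype.rTensor Y (d.lTensor N w) = 0 := by
    rw [← LinearMap.comp_apply, LinearMap.rTensor_comp_lTensor, ← LinearMap.lTensor_comp_rTensor,
      LinearMap.comp_apply, hw, ← LinearMap.comp_apply, ← LinearMap.lTensor_comp]
    have : d ∘ₗ P.subtype = 0 := LinearMap.ext fun x => LinearMap.mem_ker.1 (hP ▸ x.2)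
    rw [this, LinearMap.lTensor_zero, LinearMap.zero_apply]
  -- Flatness of `Y` makes `N ⊗ Y → F ⊗ Y` injective, so `d` kills `w` already in `N ⊗ Y`, and
  -- exactness over `N` applies.
  have h₃ := hd N w (Module.Flat.rTensor_preserves_injective_linearMap (M := Y) N.subtype
    N.subtype_injective (h₂.trans (map_zero _).symm))
  obtain ⟨v, rfl⟩ := h₃
  have h₄ : N.subtype.rTensor P v = y := by
    refine Module.Flat.lTensor_preserves_injective_linearMap (M := F) P.subtype
      P.subtype_injective ?_
    rw [← hw, ← LinearMap.comp_apply, ← LinearMap.comp_apply, LinearMap.rTensor_comp_lTensor,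
      LinearMap.lTensor_comp_rTensor]
  rw [← h₄, ← LinearMap.comp_apply, ← LinearMap.rTensor_comp]
  have : p ∘ₗ N.subtype = 0 := LinearMap.ext fun x => x.2
  rw [this, LinearMap.rTensor_zero, LinearMap.zero_apply]

end Purity

/-! ### Tensor powers of flat modules and of pure submodules. -/

section TensorPower

variable {R : Type*} [CommRing R] {X : Type*} [AddCommGroup X] [Module R X]

variable (R X) in
/-- The isomorphism `X ⊗ X^{⊗ n} ≃ X^{⊗ n + 1}`. -/
noncomputable def tensorCons (n : ℕ) : X ⊗[R] (⨂[R] _ : Fin n, X) ≃ₗ[R] ⨂[R] _ : Fin (n + 1), X :=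
  TensorProduct.congr (PiTensorProduct.subsingletonEquiv (R := R) (s := fun _ : Fin 1 => X) 0).symm
    (LinearEquiv.refl R _) ≪≫ₗ PiTensorProduct.tmulEquiv R X ≪≫ₗ
    PiTensorProduct.reindex R (fun _ => X) (finSumFinEquiv.trans (finCongr (Nat.add_comm 1 n)))

theorem tensorCons_tmul_tprod {n : ℕ} (x : X) (y : Fin n → X) :
    tensorCons R X n (x ⊗ₜ PiTensorProduct.tprod R y) =
      PiTensorProduct.tprod R (Fin.cons x y : Fin (n + 1) → X) := by
  simp only [tensorCons, LinearEquiv.trans_apply, TensorProduct.congr_tmul,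
    PiTensorProduct.subsingletonEquiv_symm_apply', LinearEquiv.refl_apply,
    PiTensorProduct.tmulEquiv_apply, PiTensorProduct.reindex_tprod]
  congr 1
  funext i
  refine Fin.cases ?_ (fun j => ?_) i
  · rfl
  · have : ((finSumFinEquiv.trans (finCongr (Nat.add_comm 1 n))).symm j.succ) = Sum.inr j := by
      rw [Equiv.symm_apply_eq]
      ext
      simp
    rw [this, Fin.cons_succ]
    rfl

theorem tensorCons_ext {E : Type*} [AddCommGroup E] [Module R E] {n : ℕ}
    {f g : X ⊗[R] (⨂[R] _ : Fin n, X) →ₗ[R] E}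
    (h : ∀ x y, f (x ⊗ₜ PiTensorProduct.tprod R y) = g (x ⊗ₜ PiTensorProduct.tprod R y)) : f = g :=
  TensorProduct.ext (LinearMap.ext fun x => PiTensorProduct.ext (MultilinearMap.ext fun y => h x y))

theorem tensorEval_tensorCons {S : Type*} [CommRing S] [Algebra R S] {n : ℕ}
    (f : Fin (n + 1) → X →ₗ[R] S) (z : X ⊗[R] (⨂[R] _ : Fin n, X)) :
    tensorEval f (tensorCons R X n z) =
      LinearMap.mul' R S (TensorProduct.map (f 0) (tensorEval fun i => f i.succ) z) := by
  refine LinearMap.congr_fun (f := tensorEval f ∘ₗ (tensorCons R X n).toLinearMap)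
    (g := LinearMap.mul' R S ∘ₗ TensorProduct.map (f 0) (tensorEval fun i => f i.succ))
    (tensorCons_ext fun x y => ?_) z
  simp [tensorCons_tmul_tprod, Fin.prod_univ_succ]

theorem map_tensorCons {P : Type*} [AddCommGroup P] [Module R P] (g : P →ₗ[R] X) {n : ℕ}
    (z : P ⊗[R] (⨂[R] _ : Fin n, P)) :
    PiTensorProduct.map (fun _ => g) (tensorCons R P n z) =
      tensorCons R X n (TensorProduct.map g (PiTensorProduct.map fun _ => g) z) := by
  refine LinearMap.congr_fun (f := PiTensorProduct.map (fun _ => g) ∘ₗ (tensorCons R P n).toLinearMap)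
    (g := (tensorCons R X n).toLinearMap ∘ₗ TensorProduct.map g (PiTensorProduct.map fun _ => g))
    (tensorCons_ext fun x y => ?_) z
  simp only [LinearMap.comp_apply, LinearEquiv.coe_coe, tensorCons_tmul_tprod,
    TensorProduct.map_tmul, PiTensorProduct.map_tprod]
  congr 1
  funext i
  refine Fin.cases ?_ (fun j => ?_) i <;> simp

instance flat_tensorPower [Module.Flat R X] (n : ℕ) : Module.Flat R (⨂[R] _ : Fin n, X) := by
  induction n with
  | zero =>
    exact Module.Flat.of_linearEquiv (PiTensorProduct.isEmptyEquiv (R := R) (s := fun _ => X) (Fin 0))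
  | succ n ih => exact Module.Flat.of_linearEquiv (tensorCons R X n).symm

end TensorPower

/-- Factor the map as `P ⊗ P^{⊗n} → X ⊗ P^{⊗n} → X ⊗ X^{⊗n}`: the first arrow is injective by
purity, the second by flatness of `X`. Only `X` has to be flat. -/
theorem tensorPower_map_injective {R : Type u} [CommRing R] {X P : Type u} [AddCommGroup X]
    [Module R X] [AddCommGroup P] [Module R P] [Module.Flat R X] (g : P →ₗ[R] X)
    (hg : ∀ (M : Type u) [AddCommGroup M] [Module R M], Function.Injective (g.lTensor M)) (n : ℕ) :
    Function.Injective (PiTensorProduct.map (ι := Fin n) (R := R) fun _ => g) := by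
  induction n with
  | zero =>
    intro x y hxy
    have key : ∀ z, PiTensorProduct.isEmptyEquiv (R := R) (s := fun _ => X) (Fin 0)
        (PiTensorProduct.map (fun _ => g) z) =
        PiTensorProduct.isEmptyEquiv (R := R) (s := fun _ => P) (Fin 0) z :=
      linearMap_apply_eq_of_tprod (f := (PiTensorProduct.isEmptyEquiv (R := R)
        (s := fun _ => X) (Fin 0)).toLinearMap ∘ₗ PiTensorProduct.map (fun _ => g))
        (g := (PiTensorProduct.isEmptyEquiv (R := R) (s := fun _ => P) (Fin 0)).toLinearMap)
        (fun y => by simp)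
    exact (PiTensorProduct.isEmptyEquiv (R := R) (s := fun _ => P) (Fin 0)).injective
      (by rw [← key, ← key, hxy])
  | succ n ih =>
    have h₁ : Function.Injective (TensorProduct.map g (PiTensorProduct.map fun _ : Fin n => g)) := by
      rw [← LinearMap.lTensor_comp_rTensor]
      refine (Module.Flat.lTensor_preserves_injective_linearMap _ ih).comp ?_
      rw [← LinearMap.lTensor_inj_iff_rTensor_inj]
      exact hg _
    intro x y hxy
    obtain ⟨x, rfl⟩ := (tensorCons R P n).surjective x
    obtain ⟨y, rfl⟩ := (tensorCons R P n).surjective y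
    rw [map_tensorCons, map_tensorCons] at hxy
    rw [h₁ ((tensorCons R X n).injective hxy)]

end ModuleFunctor

namespace FormalMonoid

open ModuleFunctor

/-! ### The filtration `K_n` and the iterated reduced comultiplication. -/

section Basic

variable {R : Type u} [CommRing R] {A : Type u} [Ring A] [Bialgebra R A]
  [Coalgebra.IsCocomm R A]

omit [Coalgebra.IsCocomm R A] in
theorem mem_augIdeal {S : Type u} [CommRing S] [Algebra R S] {f : Fun R A S} :
    f ∈ augIdeal R A S ↔ f.ofConv 1 = 0 := Iff.rfl

theorem mem_powVanishing {n : ℕ} {x : A} :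
    x ∈ powVanishing R A n ↔ ∀ (S : Type u) [CommRing S] [Algebra R S] (f : Fun R A S),
      f ∈ augIdeal R A S ^ n → f.ofConv x = 0 :=
  ⟨fun h S _ _ f hf => h S f.ofConv hf, fun h S _ _ f hf => h S (WithConv.toConv f) hf⟩

theorem eq_zero_of_mem_powVanishing_zero {x : A} (hx : x ∈ powVanishing R A 0) : x = 0 :=
  SqZero.inr_injective (S := R) <| (mem_powVanishing.1 hx (SqZero R A)
    (WithConv.toConv (SqZero.inr R A)) (by rw [pow_zero, Ideal.one_eq_top]; trivial)).trans (map_zero _).symm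

/-- The projection `A → A / R·1`, viewed in the square-zero extension by `A / R·1`, kills `1` and so
belongs to `𝓘^*`; its kernel is `R·1`. -/
theorem exists_of_mem_powVanishing_one {x : A} (hx : x ∈ powVanishing R A 1) :
    ∃ r : R, x = algebraMap R A r := by
  let W : Submodule R A := Submodule.span R {1}
  have h := mem_powVanishing.1 hx (SqZero R (A ⧸ W))
    (WithConv.toConv (SqZero.inr R (A ⧸ W) ∘ₗ W.mkQ)) (by
      rw [pow_one, mem_augIdeal]
      change SqZero.inr R (A ⧸ W) (W.mkQ 1) = 0
      rw [W.mkQ_apply, (Submodule.Quotient.mk_eq_zero W).2 (Submodule.mem_span_singleton_self 1),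
        map_zero])
  have h' : W.mkQ x = 0 := SqZero.inr_injective (S := R) (h.trans (map_zero _).symm)
  rw [W.mkQ_apply, Submodule.Quotient.mk_eq_zero, Submodule.mem_span_singleton] at h'
  obtain ⟨r, rfl⟩ := h'
  exact ⟨r, (Algebra.algebraMap_eq_smul_one r).symm⟩

theorem algebraMap_mem_powVanishing_one (r : R) : algebraMap R A r ∈ powVanishing R A 1 :=
  mem_powVanishing.2 fun S _ _ f hf => by
    rw [pow_one, mem_augIdeal] at hf
    rw [Algebra.algebraMap_eq_smul_one, map_smul, hf, smul_zero]

/-- Sums of products suffice, without coefficients, since a coefficient can be absorbed in a factor.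
This needs at least one factor, hence the exponent `n + 1`. -/
theorem mem_closure_of_mem_ideal_pow {B : Type*} [CommRing B] (I : Ideal B) (n : ℕ) {x : B}
    (hx : x ∈ I ^ (n + 1)) :
    x ∈ AddSubmonoid.closure {y | ∃ f : Fin (n + 1) → B, (∀ i, f i ∈ I) ∧ ∏ i, f i = y} := by
  induction n generalizing x with
  | zero =>
    exact AddSubmonoid.subset_closure ⟨fun _ => x, fun _ => by simpa using hx, by simp⟩
  | succ n ih =>
    rw [pow_succ'] at hx
    refine Submodule.mul_induction_on hx (fun a ha b hb => ?_) fun a b => add_mem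
    refine AddSubmonoid.closure_induction (motive := fun b _ => a * b ∈ _) (fun b hb => ?_)
      (by rw [mul_zero]; exact zero_mem _) (fun b c _ _ hb hc => by rw [mul_add]; exact add_mem hb hc)
      (ih hb)
    obtain ⟨f, hf, rfl⟩ := hb
    exact AddSubmonoid.subset_closure ⟨Fin.cons a f, Fin.cases ha hf, by simp [Fin.prod_univ_succ]⟩

theorem mem_powVanishing_succ {n : ℕ} {x : A} :
    x ∈ powVanishing R A (n + 1) ↔ ∀ (S : Type u) [CommRing S] [Algebra R S]
      (f : Fin (n + 1) → Fun R A S), (∀ i, f i ∈ augIdeal R A S) → (∏ i, f i).ofConv x = 0 := by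
  rw [mem_powVanishing]
  refine ⟨fun h S _ _ f hf => h S _ (prod_mem_augIdeal_pow f hf), fun h S _ _ f hf => ?_⟩
  refine AddSubmonoid.closure_induction (motive := fun (g : Fun R A S) _ => g.ofConv x = 0)
    (fun g hg => ?_) rfl (fun g g' _ _ hg hg' => ?_) (mem_closure_of_mem_ideal_pow _ n hf)
  · obtain ⟨f, hf, rfl⟩ := hg
    exact h S f hf
  · change g.ofConv x + g'.ofConv x = 0
    rw [hg, hg', add_zero]

variable (R A) in
/-- The projection `A → I = A / R`. -/
noncomputable def augProj : A →ₗ[R] PowModule R A 1 := (powVanishing R A 1).mkQ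

theorem augProj_surjective : Function.Surjective (augProj R A) := Submodule.mkQ_surjective _

theorem augProj_eq_zero {a : A} : augProj R A a = 0 ↔ a ∈ powVanishing R A 1 :=
  Submodule.Quotient.mk_eq_zero _

theorem augProj_algebraMap (r : R) : augProj R A (algebraMap R A r) = 0 :=
  augProj_eq_zero.2 (algebraMap_mem_powVanishing_one r)

theorem augProj_one : augProj R A 1 = 0 := by
  simpa using augProj_algebraMap (A := A) (1 : R)

/-- An element of `𝓘^*(S)` defined by a linear map `A / R → S`. -/
noncomputable def ofAug {S : Type u} [CommRing S] [Algebra R S] (f : PowModule R A 1 →ₗ[R] S) :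
    Fun R A S := WithConv.toConv (f ∘ₗ augProj R A)

theorem ofAug_mem {S : Type u} [CommRing S] [Algebra R S] (f : PowModule R A 1 →ₗ[R] S) :
    ofAug f ∈ augIdeal R A S := by
  rw [mem_augIdeal]
  change f (augProj R A 1) = 0
  rw [augProj_one, map_zero]

theorem exists_eq_ofAug {S : Type u} [CommRing S] [Algebra R S] {f : Fun R A S}
    (hf : f ∈ augIdeal R A S) : ∃ g : PowModule R A 1 →ₗ[R] S, f = ofAug g :=
  ⟨powMk R A 1 f (by rwa [pow_one]), rfl⟩

variable (R A) in
/-- The iterated reduced comultiplication `A → I ⊗ ⋯ ⊗ I`. -/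
noncomputable def iterComul : ∀ n : ℕ, A →ₗ[R] ⨂[R] _ : Fin n, PowModule R A 1
  | 0 => (PiTensorProduct.isEmptyEquiv (R := R) (s := fun _ => PowModule R A 1)
      (Fin 0)).symm.toLinearMap ∘ₗ Coalgebra.counit
  | n + 1 => (tensorCons R (PowModule R A 1) n).toLinearMap ∘ₗ
      TensorProduct.map (augProj R A) (iterComul n) ∘ₗ Coalgebra.comul

theorem iterComul_zero (a : A) : iterComul R A 0 a = (PiTensorProduct.isEmptyEquiv (R := R)
    (s := fun _ => PowModule R A 1) (Fin 0)).symm (Coalgebra.counit a) := rfl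

theorem iterComul_succ (n : ℕ) (a : A) : iterComul R A (n + 1) a =
    tensorCons R (PowModule R A 1) n
      (TensorProduct.map (augProj R A) (iterComul R A n) (Coalgebra.comul a)) := rfl

/-- A convolution product is a tensor product of forms composed with the iterated comultiplication,
and forms that kill `1` factor through `I`. This turns vanishing of products into vanishing of a
tensor. -/
theorem tensorEval_iterComul {n : ℕ} {S : Type u} [CommRing S] [Algebra R S]
    (f : Fin n → PowModule R A 1 →ₗ[R] S) (a : A) :
    tensorEval f (iterComul R A n a) = (∏ i, ofAug (f i)).ofConv a := by
  induction n generalizing a with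
  | zero =>
    rw [iterComul_zero]
    change tensorEval f (Coalgebra.counit (R := R) a • PiTensorProduct.tprod R isEmptyElim) = _
    simp [Algebra.algebraMap_eq_smul_one, LinearMap.convOne_def]
  | succ n ih =>
    have ih' : tensorEval (fun i => f (Fin.succ i)) ∘ₗ iterComul R A n =
        (∏ i, ofAug (f (Fin.succ i))).ofConv := LinearMap.ext fun a => ih _ a
    rw [iterComul_succ, tensorEval_tensorCons, Fin.prod_univ_succ, TensorProduct.map_map, ih']
    rfl

/-- Tensors are separated by products of forms. Exponent `0` is excluded: `K_0 = 0`, whereas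
`iterComul R A 0` is the counit. -/
theorem mem_powVanishing_succ_iff {n : ℕ} {a : A} :
    a ∈ powVanishing R A (n + 1) ↔ iterComul R A (n + 1) a = 0 := by
  rw [mem_powVanishing_succ]
  refine ⟨fun h => eq_zero_of_tensorEval _ fun S _ _ f => ?_, fun h S _ _ f hf => ?_⟩
  · rw [tensorEval_iterComul]
    exact h S _ fun i => ofAug_mem _
  · choose g hg using fun i => exists_eq_ofAug (hf i)
    obtain rfl : f = fun i => ofAug (g i) := funext hg
    rw [← tensorEval_iterComul, h, map_zero]

theorem iterComul_eq_zero {n : ℕ} {a : A} (h : a ∈ powVanishing R A n) : iterComul R A n a = 0 := by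
  cases n with
  | zero => rw [eq_zero_of_mem_powVanishing_zero h, map_zero]
  | succ n => exact mem_powVanishing_succ_iff.1 h

/-- Inside `K_{n+1}` the kernel description also holds for `n = 0`, because the counit is injective
on `K_1 = R·1`. -/
theorem mem_powVanishing_iff {n : ℕ} {a : A} (ha : a ∈ powVanishing R A (n + 1)) :
    a ∈ powVanishing R A n ↔ iterComul R A n a = 0 := by
  refine ⟨iterComul_eq_zero, fun h => ?_⟩
  cases n with
  | zero =>
    obtain ⟨r, rfl⟩ := exists_of_mem_powVanishing_one ha
    rw [iterComul_zero, LinearEquiv.map_eq_zero_iff, Bialgebra.counit_algebraMap] at h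
    rw [h, map_zero]
    exact zero_mem _
  | succ n => exact mem_powVanishing_succ_iff.2 h

variable (R A) in
/-- The section `A / R → A` with values in the augmentation ideal of `A`. -/
noncomputable def augSection : PowModule R A 1 →ₗ[R] A :=
  (powVanishing R A 1).liftQ (LinearMap.id - Algebra.linearMap R A ∘ₗ Coalgebra.counit)
    fun x hx => by
      obtain ⟨r, rfl⟩ := exists_of_mem_powVanishing_one hx
      simp

theorem augSection_augProj (a : A) :
    augSection R A (augProj R A a) = a - algebraMap R A (Coalgebra.counit a) := rfl

theorem augProj_augSection (x : PowModule R A 1) : augProj R A (augSection R A x) = x := by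
  obtain ⟨a, rfl⟩ := augProj_surjective x
  rw [augSection_augProj, map_sub, augProj_algebraMap, sub_zero]

theorem flat_powModule_one [Module.Flat R A] : Module.Flat R (PowModule R A 1) :=
  Module.Flat.of_retract (augSection R A) (augProj R A) (LinearMap.ext augProj_augSection)

variable (R A) in
/-- The reduced comultiplication `I → I ⊗ I`. -/
noncomputable def redComul : PowModule R A 1 →ₗ[R] PowModule R A 1 ⊗[R] PowModule R A 1 :=
  (powVanishing R A 1).liftQ (TensorProduct.map (augProj R A) (augProj R A) ∘ₗ Coalgebra.comul)
    fun x hx => by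
      obtain ⟨r, rfl⟩ := exists_of_mem_powVanishing_one hx
      simp [Algebra.TensorProduct.algebraMap_apply, augProj_one]

theorem redComul_augProj (a : A) : redComul R A (augProj R A a) =
    TensorProduct.map (augProj R A) (augProj R A) (Coalgebra.comul a) := rfl

theorem iterComul_one (a : A) : iterComul R A 1 a =
    (PiTensorProduct.subsingletonEquiv (R := R) (s := fun _ : Fin 1 => PowModule R A 1) 0).symm
      (augProj R A a) :=
  eq_of_tensorEval fun S _ _ f => by
    rw [tensorEval_iterComul, PiTensorProduct.subsingletonEquiv_symm_apply', tensorEval_tprod]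
    simp
    rfl

theorem iterComul_two (a : A) : iterComul R A 2 a = tensorCons R (PowModule R A 1) 1
    ((PiTensorProduct.subsingletonEquiv (R := R)
      (s := fun _ : Fin 1 => PowModule R A 1) 0).symm.toLinearMap.lTensor _
      (redComul R A (augProj R A a))) := by
  have h : iterComul R A 1 = (PiTensorProduct.subsingletonEquiv (R := R)
      (s := fun _ : Fin 1 => PowModule R A 1) 0).symm.toLinearMap ∘ₗ augProj R A :=
    LinearMap.ext iterComul_one
  rw [iterComul_succ, redComul_augProj, h, LinearMap.lTensor, TensorProduct.map_map,
    LinearMap.id_comp]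

theorem redComul_augProj_eq_zero {a : A} :
    redComul R A (augProj R A a) = 0 ↔ a ∈ powVanishing R A 2 := by
  rw [mem_powVanishing_succ_iff, iterComul_two, LinearEquiv.map_eq_zero_iff]
  exact ((LinearEquiv.lTensor _ (PiTensorProduct.subsingletonEquiv (R := R)
      (s := fun _ : Fin 1 => PowModule R A 1) 0).symm).map_eq_zero_iff).symm

theorem augProj_mem_ker_powStep {a : A} :
    augProj R A a ∈ LinearMap.ker (powStep R A 1) ↔ a ∈ powVanishing R A 2 := by
  rw [LinearMap.mem_ker]
  exact Submodule.Quotient.mk_eq_zero _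

theorem ker_powStep_one : LinearMap.ker (powStep R A 1) = LinearMap.ker (redComul R A) := by
  ext x
  obtain ⟨a, rfl⟩ := augProj_surjective x
  rw [augProj_mem_ker_powStep, LinearMap.mem_ker, redComul_augProj_eq_zero]

end Basic

/-! ### Consequences of base change: purity of `P`, and the image of `K_{n+1}` in `P^{⊗n}`. -/

section BaseChange

variable {R : Type u} [CommRing R] {A : Type u} [Ring A] [Bialgebra R A]
  [Coalgebra.IsCocomm R A]

/-- An element of `K_n(S ⊗ A)` is the image of an element of `S ⊗ K_n(A)`. -/
theorem IsFlatInfinitesimal.mem_range_of_mem_powVanishing (hG : IsFlatInfinitesimal R A) (n : ℕ)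
    (S : Type u) [CommRing S] [Algebra R S] {y : S ⊗[R] A}
    (hy : y ∈ powVanishing S (S ⊗[R] A) n) :
    y ∈ LinearMap.range ((powVanishing R A n).subtype.lTensor S) := by
  -- The test form is the projection of `S ⊗ A` onto its quotient by the image `W` of `S ⊗ K_n`. Its
  -- restriction to `A` vanishes on `K_n`, so by base change it vanishes at `y`.
  let W : Submodule S (S ⊗[R] A) := LinearMap.range ((powVanishing R A n).subtype.baseChange S)
  let T := SqZero S ((S ⊗[R] A) ⧸ W)
  let g : S ⊗[R] A →ₗ[S] T := SqZero.inr S _ ∘ₗ W.mkQ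
  let f : A →ₗ[R] T := g.restrictScalars R ∘ₗ TensorProduct.mk R S A 1
  have hfg : f.liftBaseChange S = g := by
    ext a
    simp [f]
  have hf : MemPow n f := fun x hx => by
    have : (1 : S) ⊗ₜ[R] x ∈ W := ⟨1 ⊗ₜ ⟨x, hx⟩, rfl⟩
    change SqZero.inr S _ (W.mkQ (1 ⊗ₜ x)) = 0
    rw [W.mkQ_apply, (Submodule.Quotient.mk_eq_zero W).2 this, map_zero]
  have h₁ := (hG.baseChange n S T f).1 hf y hy
  rw [hfg] at h₁
  have h₂ : W.mkQ y = 0 := SqZero.inr_injective (S := S) (h₁.trans (map_zero _).symm)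
  rw [W.mkQ_apply, Submodule.Quotient.mk_eq_zero] at h₂
  exact h₂

variable (R A) in
/-- The restriction of linear forms from `S ⊗ A` to `A`, a homomorphism for the convolution
products. -/
noncomputable def restrictForm (S T : Type u) [CommRing S] [Algebra R S] [CommRing T] [Algebra S T]
    [Algebra R T] [IsScalarTower R S T] : Fun S (S ⊗[R] A) T →* Fun R A T where
  toFun f := WithConv.toConv (f.ofConv.restrictScalars R ∘ₗ TensorProduct.mk R S A 1)
  map_one' := by
    refine WithConv.ofConv_injective (LinearMap.ext fun a => ?_)
    change algebraMap S T (Coalgebra.counit (R := S) ((1 : S) ⊗ₜ[R] a)) =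
      algebraMap R T (Coalgebra.counit a)
    simp [IsScalarTower.algebraMap_apply R S T, Algebra.algebraMap_eq_smul_one]
  map_mul' f g := by
    refine WithConv.ofConv_injective (LinearMap.ext fun a => ?_)
    change LinearMap.mul' S T (TensorProduct.map f.ofConv g.ofConv
      (Coalgebra.comul (R := S) ((1 : S) ⊗ₜ[R] a))) = LinearMap.mul' R T (TensorProduct.map _ _
        (Coalgebra.comul (R := R) a))
    rw [TensorProduct.comul_tmul, ← (Coalgebra.Repr.arbitrary R a).eq]
    simp [TensorProduct.tmul_sum]

omit [Coalgebra.IsCocomm R A] in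
theorem restrictForm_apply {S T : Type u} [CommRing S] [Algebra R S] [CommRing T] [Algebra S T]
    [Algebra R T] [IsScalarTower R S T] (f : Fun S (S ⊗[R] A) T) (a : A) :
    (restrictForm R A S T f).ofConv a = f.ofConv (1 ⊗ₜ a) := rfl

omit [Coalgebra.IsCocomm R A] in
theorem ofConv_tmul {S T : Type u} [CommRing S] [Algebra R S] [CommRing T] [Algebra S T]
    [Algebra R T] [IsScalarTower R S T] (f : Fun S (S ⊗[R] A) T) (s : S) (a : A) :
    f.ofConv (s ⊗ₜ a) = s • (restrictForm R A S T f).ofConv a := by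
  rw [restrictForm_apply, ← map_smul, TensorProduct.smul_tmul', smul_eq_mul, mul_one]

omit [Coalgebra.IsCocomm R A] in
theorem restrictForm_mem {S T : Type u} [CommRing S] [Algebra R S] [CommRing T] [Algebra S T]
    [Algebra R T] [IsScalarTower R S T] {f : Fun S (S ⊗[R] A) T}
    (hf : f ∈ augIdeal S (S ⊗[R] A) T) : restrictForm R A S T f ∈ augIdeal R A T := hf

/-- Forms on `S ⊗ A` are determined by their restrictions to `A`, and restriction is multiplicative.
A product of such forms is thus the `S`-linear extension of an evaluation of `iterComul`. -/
theorem mem_powVanishing_baseChange {n : ℕ} {S : Type u} [CommRing S] [Algebra R S] {y : S ⊗[R] A}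
    (hy : (iterComul R A (n + 1)).lTensor S y = 0) :
    y ∈ powVanishing S (S ⊗[R] A) (n + 1) := by
  refine mem_powVanishing_succ.2 fun T _ _ f hf => ?_
  let : Algebra R T := Algebra.compHom T (algebraMap R S)
  have : IsScalarTower R S T := IsScalarTower.of_algebraMap_eq fun _ => rfl
  choose g hg using fun i => exists_eq_ofAug (restrictForm_mem (hf i))
  have key : (∏ i, f i).ofConv.restrictScalars R =
      ((tensorEval g).liftBaseChange S).restrictScalars R ∘ₗ (iterComul R A (n + 1)).lTensor S := by
    refine TensorProduct.ext' fun s a => ?_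
    change (∏ i, f i).ofConv (s ⊗ₜ a) = s • tensorEval g (iterComul R A (n + 1) a)
    rw [ofConv_tmul, map_prod, tensorEval_iterComul]
    simp only [hg]
  refine (LinearMap.congr_fun key y).trans ?_
  rw [LinearMap.comp_apply, hy, map_zero]

theorem exists_iterComul_two : ∃ E : PowModule R A 1 ⊗[R] PowModule R A 1 →ₗ[R] _,
    iterComul R A 2 = E ∘ₗ redComul R A ∘ₗ augProj R A :=
  ⟨(tensorCons R (PowModule R A 1) 1).toLinearMap ∘ₗ
    (PiTensorProduct.subsingletonEquiv (R := R)
      (s := fun _ : Fin 1 => PowModule R A 1) 0).symm.toLinearMap.lTensor _,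
    LinearMap.ext iterComul_two⟩

variable (R A) in
/-- The module `P` of primitive elements, with `𝓘^*/𝓘^{*2} = 𝓟^*`. -/
noncomputable abbrev Primitive : Submodule R (PowModule R A 1) := LinearMap.ker (powStep R A 1)

/-- Exactness of `M ⊗ P → M ⊗ I → M ⊗ I ⊗ I` is base change to the algebra `R ⊕ M` in degree `2`: `M
⊗ A` sits in `(R ⊕ M) ⊗ A`, and the projection to `M` brings the preimage back. -/
theorem IsFlatInfinitesimal.mem_range_lTensor (hG : IsFlatInfinitesimal R A) (M : Type u)
    [AddCommGroup M] [Module R M] (x : M ⊗[R] PowModule R A 1)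
    (hx : (redComul R A).lTensor M x = 0) :
    x ∈ LinearMap.range ((Primitive R A).subtype.lTensor M) := by
  obtain ⟨y, rfl⟩ := LinearMap.lTensor_surjective M augProj_surjective x
  have hy : (SqZero.inr R M).rTensor A y ∈ powVanishing (SqZero R M) (SqZero R M ⊗[R] A) 2 := by
    refine mem_powVanishing_baseChange ?_
    obtain ⟨E, hE⟩ := exists_iterComul_two (R := R) (A := A)
    rw [← LinearMap.comp_apply, LinearMap.lTensor_comp_rTensor, ← LinearMap.rTensor_comp_lTensor,
      LinearMap.comp_apply, hE, LinearMap.lTensor_comp_apply, LinearMap.lTensor_comp_apply, hx,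
      map_zero, map_zero]
  obtain ⟨v, hv⟩ := hG.mem_range_of_mem_powVanishing 2 _ hy
  let c : powVanishing R A 2 →ₗ[R] Primitive R A :=
    (augProj R A ∘ₗ (powVanishing R A 2).subtype).codRestrict _
      fun a => augProj_mem_ker_powStep.2 a.2
  have hc : augProj R A ∘ₗ (powVanishing R A 2).subtype = (Primitive R A).subtype ∘ₗ c := rfl
  refine ⟨c.lTensor M ((SqZero.snd R M).rTensor _ v), ?_⟩
  have h₁ : (SqZero.snd R M).rTensor A ((SqZero.inr R M).rTensor A y) = y := by
    rw [← LinearMap.rTensor_comp_apply]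
    have : SqZero.snd R M ∘ₗ SqZero.inr R M = LinearMap.id := rfl
    rw [this, LinearMap.rTensor_id_apply]
  rw [← LinearMap.lTensor_comp_apply, ← hc, LinearMap.lTensor_comp_apply, ← h₁, ← hv]
  congr 1
  rw [← LinearMap.comp_apply, LinearMap.lTensor_comp_rTensor, ← LinearMap.comp_apply,
    LinearMap.rTensor_comp_lTensor]

theorem IsFlatInfinitesimal.mem_range_rTensor (hG : IsFlatInfinitesimal R A) {M : Type u}
    [AddCommMonoid M] [Module R M] (x : PowModule R A 1 ⊗[R] M)
    (hx : (redComul R A).rTensor M x = 0) :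
    x ∈ LinearMap.range ((Primitive R A).subtype.rTensor M) := by
  let : AddCommGroup M := Module.addCommMonoidToAddCommGroup R
  obtain ⟨w, hw⟩ := hG.mem_range_lTensor M (TensorProduct.comm R _ _ x) (by
    rw [← LinearMap.comm_comp_rTensor_comp_comm_eq]
    simp [hx])
  refine ⟨TensorProduct.comm R _ _ w, ?_⟩
  rw [← LinearMap.comm_comp_lTensor_comp_comm_eq]
  simp [hw]

theorem IsFlatInfinitesimal.lTensor_primitive_injective (hG : IsFlatInfinitesimal R A) (M : Type u)
    [AddCommGroup M] [Module R M] :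
    Function.Injective ((Primitive R A).subtype.lTensor M) :=
  haveI := hG.flat
  haveI := flat_powModule_one (R := R) (A := A)
  lTensor_subtype_injective_of_exact (redComul R A) ker_powStep_one hG.mem_range_lTensor M

variable (R A) in
/-- The map `P ⊗ ⋯ ⊗ P → I ⊗ ⋯ ⊗ I`. -/
noncomputable abbrev primIncl (n : ℕ) :
    (⨂[R] _ : Fin n, Primitive R A) →ₗ[R] ⨂[R] _ : Fin n, PowModule R A 1 :=
  PiTensorProduct.map fun _ => (Primitive R A).subtype

theorem IsFlatInfinitesimal.primIncl_injective (hG : IsFlatInfinitesimal R A) (n : ℕ) :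
    Function.Injective (primIncl R A n) :=
  haveI := hG.flat
  haveI := flat_powModule_one (R := R) (A := A)
  tensorPower_map_injective _ hG.lTensor_primitive_injective n

theorem exists_comp_eq_of_mem_range {R M N Q : Type*} [Semiring R] [AddCommMonoid M] [Module R M]
    [AddCommMonoid N] [Module R N] [AddCommMonoid Q] [Module R Q] {f : M →ₗ[R] Q} {g : N →ₗ[R] Q}
    (hg : Function.Injective g) (h : ∀ x, f x ∈ LinearMap.range g) : ∃ t, g ∘ₗ t = f :=
  ⟨(LinearEquiv.ofInjective g hg).symm.toLinearMap ∘ₗ f.codRestrict _ h, LinearMap.ext fun x =>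
    congrArg Subtype.val ((LinearEquiv.ofInjective g hg).apply_symm_apply ⟨f x, h x⟩)⟩

theorem exists_lTensor_subtype_eq {R M N X : Type*} [CommRing R] [AddCommGroup M] [Module R M]
    [AddCommGroup N] [Module R N] [AddCommGroup X] [Module R X] [Module.Flat R X] (f : M →ₗ[R] N)
    {K : Submodule R M} (hK : ∀ x, x ∈ K ↔ f x = 0) {z : X ⊗[R] M} (hz : f.lTensor X z = 0) :
    ∃ v, K.subtype.lTensor X v = z := by
  have hex : Function.Exact K.subtype f := fun b => ⟨fun hb => ⟨⟨b, (hK b).2 hb⟩, rfl⟩,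
    fun ⟨b', hb'⟩ => hb' ▸ (hK b').1 b'.2⟩
  exact (Module.Flat.lTensor_exact X hex z).1 hz

theorem IsFlatInfinitesimal.exists_lTensor_eq (hG : IsFlatInfinitesimal R A) {n : ℕ}
    {z : PowModule R A 1 ⊗[R] A} (hz : (iterComul R A (n + 1)).lTensor _ z = 0) :
    ∃ v, (powVanishing R A (n + 1)).subtype.lTensor (PowModule R A 1) v = z := by
  have := hG.flat
  have := flat_powModule_one (R := R) (A := A)
  have h := exists_lTensor_subtype_eq (R := R) (M := A) (N := ⨂[R] _ : Fin (n + 1), PowModule R A 1)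
    (X := PowModule R A 1) (iterComul R A (n + 1)) (K := powVanishing R A (n + 1))
    (by intro x; exact mem_powVanishing_succ_iff) (z := z)
  exact h hz

/-- Coassociativity: applying the reduced comultiplication to the first factor of `iterComul R A (n
+ 1) a` yields `iterComul R A (n + 2) a`. -/
theorem map_redComul_iterComul (n : ℕ) (a : A) :
    (tensorCons R (PowModule R A 1) n).toLinearMap.lTensor (PowModule R A 1)
      (TensorProduct.assoc R _ _ _ (TensorProduct.map (redComul R A ∘ₗ augProj R A)
        (iterComul R A n) (Coalgebra.comul a))) =
      (tensorCons R (PowModule R A 1) (n + 1)).symm (iterComul R A (n + 2) a) := by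
  have h₁ : redComul R A ∘ₗ augProj R A =
      TensorProduct.map (augProj R A) (augProj R A) ∘ₗ Coalgebra.comul := rfl
  have h₂ : iterComul R A (n + 1) = (tensorCons R (PowModule R A 1) n).toLinearMap ∘ₗ
      TensorProduct.map (augProj R A) (iterComul R A n) ∘ₗ Coalgebra.comul := rfl
  rw [iterComul_succ (n + 1), LinearEquiv.symm_apply_apply, h₁, h₂]
  have h₃ : TensorProduct.map (TensorProduct.map (augProj R A) (augProj R A) ∘ₗ Coalgebra.comul)
      (iterComul R A n) = TensorProduct.map (TensorProduct.map (augProj R A) (augProj R A))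
      (iterComul R A n) ∘ₗ Coalgebra.comul.rTensor A := by
    rw [LinearMap.rTensor, ← TensorProduct.map_comp, LinearMap.comp_id]
  rw [h₃, LinearMap.comp_apply, ← TensorProduct.map_map_assoc, Coalgebra.coassoc_apply,
    LinearMap.lTensor, LinearMap.lTensor, TensorProduct.map_map, TensorProduct.map_map]
  rfl

/-- Induction on `n`. For `a ∈ K_{n+2}`, flatness of `I` and the inductive hypothesis put the image
of `a` in `I ⊗ P^{⊗n}`; coassociativity shows that the first factor is primitive as well. -/
theorem IsFlatInfinitesimal.exists_primIncl_comp_eq (hG : IsFlatInfinitesimal R A) (n : ℕ) :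
    ∃ t : powVanishing R A (n + 1) →ₗ[R] ⨂[R] _ : Fin n, Primitive R A,
      primIncl R A n ∘ₗ t = iterComul R A n ∘ₗ (powVanishing R A (n + 1)).subtype := by
  have := hG.flat
  have := flat_powModule_one (R := R) (A := A)
  induction n with
  | zero =>
    refine exists_comp_eq_of_mem_range (hG.primIncl_injective 0) fun a => ?_
    refine ⟨Coalgebra.counit (R := R) a.1 • PiTensorProduct.tprod R isEmptyElim, ?_⟩
    rw [map_smul, PiTensorProduct.map_tprod]
    change _ = Coalgebra.counit (R := R) a.1 • PiTensorProduct.tprod R isEmptyElim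
    congr 2
    exact Subsingleton.elim _ _
  | succ n ih =>
    refine exists_comp_eq_of_mem_range (hG.primIncl_injective _) fun ⟨a, ha⟩ => ?_
    obtain ⟨t, ht⟩ := ih
    let X := PowModule R A 1
    rw [mem_powVanishing_succ_iff] at ha
    have h₁ : (iterComul R A (n + 1)).lTensor X ((augProj R A).rTensor A (Coalgebra.comul a)) = 0 := by
      rw [← LinearMap.comp_apply, LinearMap.lTensor_comp_rTensor]
      exact (tensorCons R X (n + 1)).map_eq_zero_iff.1 ha
    obtain ⟨v, hv⟩ := hG.exists_lTensor_eq h₁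
    have h₂ : (primIncl R A n).lTensor X (t.lTensor X v) =
        TensorProduct.map (augProj R A) (iterComul R A n) (Coalgebra.comul a) := by
      rw [← LinearMap.lTensor_comp_apply, ht, LinearMap.lTensor_comp_apply, hv,
        ← LinearMap.comp_apply, LinearMap.lTensor_comp_rTensor]
    -- Checked after the injection into `I ⊗ I ⊗ I^{⊗n}`, where the element becomes `iterComul R A
    -- (n + 2) a = 0`.
    have h₃ : (redComul R A).rTensor _ (t.lTensor X v) = 0 := by
      have hinj : Function.Injective ((primIncl R A n).lTensor (X ⊗[R] X)) :=
        Module.Flat.lTensor_preserves_injective_linearMap _ (hG.primIncl_injective n)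
      refine hinj ?_
      rw [map_zero, ← LinearMap.comp_apply, LinearMap.lTensor_comp_rTensor,
        ← LinearMap.rTensor_comp_lTensor, LinearMap.comp_apply, h₂, LinearMap.rTensor,
        TensorProduct.map_map, LinearMap.id_comp]
      have := map_redComul_iterComul (R := R) n a
      rw [ha, map_zero] at this
      exact (TensorProduct.assoc R X X _).map_eq_zero_iff.1
        ((LinearEquiv.lTensor X (tensorCons R X n)).map_eq_zero_iff.1 this)
    obtain ⟨w, hw⟩ := hG.mem_range_rTensor _ h₃
    refine ⟨tensorCons R (Primitive R A) n w, ?_⟩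
    rw [map_tensorCons]
    change _ = iterComul R A (n + 1) a
    rw [iterComul_succ, ← h₂, ← hw, ← LinearMap.lTensor_comp_rTensor, LinearMap.comp_apply]

end BaseChange

/-! ### Derivations of products, and permanents. -/

theorem leibniz_prod {B : Type*} [CommRing B] (D : B →+ B)
    (hD : ∀ x y, D (x * y) = D x * y + x * D y) {ι : Type*} [DecidableEq ι] (s : Finset ι)
    (f : ι → B) : D (∏ i ∈ s, f i) = ∑ i ∈ s, D (f i) * ∏ j ∈ s.erase i, f j := by
  induction s using Finset.induction_on with
  | empty => simpa using hD 1 1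
  | insert a s ha ih =>
    rw [Finset.prod_insert ha, hD, ih, Finset.sum_insert ha, Finset.erase_insert ha, Finset.mul_sum]
    congr 1
    refine Finset.sum_congr rfl fun i hi => ?_
    have hia : a ≠ i := fun h => ha (h ▸ hi)
    rw [Finset.erase_insert_of_ne hia, Finset.prod_insert fun h => ha (Finset.mem_of_mem_erase h)]
    ring

/-- The indices other than `p` are listed as `swap 0 p j.succ`, to match `Equiv.Perm.decomposeFin`
in the expansion of the permanent. -/
theorem leibniz_prod_fin {B : Type*} [CommRing B] (D : B →+ B)
    (hD : ∀ x y, D (x * y) = D x * y + x * D y) {n : ℕ} (f : Fin (n + 1) → B) :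
    D (∏ i, f i) = ∑ p, D (f p) * ∏ j : Fin n, f (Equiv.swap 0 p j.succ) := by
  rw [leibniz_prod D hD]
  refine Finset.sum_congr rfl fun p _ => ?_
  congr 1
  have : Finset.univ.erase p =
      Finset.univ.map ((Fin.succEmb n).trans (Equiv.swap 0 p).toEmbedding) := by
    ext i
    simp only [Finset.mem_erase, Finset.mem_univ, and_true, Finset.mem_map, true_and,
      Function.Embedding.trans_apply, Equiv.toEmbedding_apply]
    constructor
    · intro hi
      obtain ⟨j, hj⟩ := Fin.exists_succ_eq.2 (show Equiv.swap 0 p i ≠ 0 from fun h => hi (by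
        simpa using congrArg (Equiv.swap 0 p) h))
      exact ⟨j, by simp [hj]⟩
    · rintro ⟨j, rfl⟩ h
      have := congrArg (Equiv.swap 0 p) h
      simp at this
  rw [this, Finset.prod_map]
  rfl

/-- Expansion of a permanent along the first row. -/
theorem sum_perm_succ {S : Type*} [CommRing S] {n : ℕ} (M : Fin (n + 1) → Fin (n + 1) → S) :
    ∑ e : Equiv.Perm (Fin (n + 1)), ∏ i, M (e i) i =
      ∑ p, M p 0 * ∑ e : Equiv.Perm (Fin n), ∏ j : Fin n, M (Equiv.swap 0 p (e j).succ) j.succ := by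
  rw [← Equiv.Perm.decomposeFin.symm.sum_comp, Fintype.sum_prod_type]
  refine Finset.sum_congr rfl fun p _ => ?_
  rw [Finset.mul_sum]
  refine Finset.sum_congr rfl fun e _ => ?_
  rw [Fin.prod_univ_succ]
  simp

/-! ### Products of primitive elements. -/

section Primitive

variable {R : Type u} [CommRing R] {A : Type u} [Ring A] [Bialgebra R A]
  [Coalgebra.IsCocomm R A]

/-- Let `u` be the counit followed by the unit. The lift `q` has counit `0`, and `(id - u) ⊗ (id -
u)` kills its coproduct because `x` is primitive; expanding the four terms gives the formula. -/
theorem comul_augSection (x : Primitive R A) :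
    Coalgebra.comul (R := R) (augSection R A x) =
      augSection R A x ⊗ₜ[R] 1 + 1 ⊗ₜ[R] augSection R A x := by
  obtain ⟨x, hx⟩ := x
  set q := augSection R A x
  have hε : Coalgebra.counit (R := R) q = 0 := by
    obtain ⟨a, rfl⟩ := augProj_surjective x
    simp [q, augSection_augProj]
  have hq : TensorProduct.map (augProj R A) (augProj R A) (Coalgebra.comul q) = 0 := by
    rw [← redComul_augProj, augProj_augSection]
    exact LinearMap.mem_ker.1 (ker_powStep_one (R := R) (A := A) ▸ hx)
  let u : A →ₗ[R] A := Algebra.linearMap R A ∘ₗ Coalgebra.counit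
  have hs : augSection R A ∘ₗ augProj R A = LinearMap.id - u := rfl
  have h := congrArg (TensorProduct.map (augSection R A) (augSection R A)) hq
  rw [TensorProduct.map_map, hs, map_zero] at h
  have h₁ : TensorProduct.map LinearMap.id u (Coalgebra.comul q) = q ⊗ₜ[R] 1 := by
    have := congrArg ((Algebra.linearMap R A).lTensor A) (Coalgebra.lTensor_counit_comul (R := R) q)
    rw [← LinearMap.lTensor_comp_apply] at this
    simpa [LinearMap.lTensor] using this
  have h₂ : TensorProduct.map u LinearMap.id (Coalgebra.comul q) = 1 ⊗ₜ[R] q := by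
    have := congrArg ((Algebra.linearMap R A).rTensor A) (Coalgebra.rTensor_counit_comul (R := R) q)
    rw [← LinearMap.rTensor_comp_apply] at this
    simpa [LinearMap.rTensor] using this
  have h₃ : TensorProduct.map u u (Coalgebra.comul q) = 0 := by
    have : TensorProduct.map u u (Coalgebra.comul q) = TensorProduct.map u LinearMap.id
        (TensorProduct.map LinearMap.id u (Coalgebra.comul q)) := by
      rw [TensorProduct.map_map]; rfl
    rw [this, h₁]
    simp [u, hε]
  have h₄ : TensorProduct.map (LinearMap.id - u) (LinearMap.id - u) =
      TensorProduct.map LinearMap.id LinearMap.id - TensorProduct.map LinearMap.id u -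
        TensorProduct.map u LinearMap.id + TensorProduct.map u u :=
    TensorProduct.ext' fun a b => by
      simp [TensorProduct.tmul_sub, TensorProduct.sub_tmul]; abel
  rw [h₄] at h
  simp only [LinearMap.add_apply, LinearMap.sub_apply, h₁, h₂, h₃, TensorProduct.map_id,
    LinearMap.id_apply, add_zero] at h
  rw [← sub_eq_zero, ← h]
  abel

variable {S : Type u} [CommRing S] [Algebra R S]

/-- The operator `f ↦ f(q ·)` on `𝓐^*(S)`. -/
noncomputable def leftOp (q : A) : Fun R A S →+ Fun R A S where
  toFun f := WithConv.toConv (f.ofConv ∘ₗ LinearMap.mulLeft R q)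
  map_zero' := rfl
  map_add' _ _ := rfl

omit [Coalgebra.IsCocomm R A] in
theorem leftOp_apply (q a : A) (f : Fun R A S) : (leftOp q f).ofConv a = f.ofConv (q * a) := rfl

/-- Since `q` is primitive, `Δ(qa) = (q ⊗ 1 + 1 ⊗ q) Δ(a)`, so `f ↦ f(q ·)` is a derivation of the
convolution product. -/
theorem leftOp_mul (x : Primitive R A) (f g : Fun R A S) :
    leftOp (augSection R A x) (f * g) =
      leftOp (augSection R A x) f * g + f * leftOp (augSection R A x) g := by
  refine WithConv.ofConv_injective (LinearMap.ext fun a => ?_)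
  set q := augSection R A x with hq
  change LinearMap.mul' R S (TensorProduct.map f.ofConv g.ofConv (Coalgebra.comul (q * a))) =
    LinearMap.mul' R S (TensorProduct.map (leftOp q f).ofConv g.ofConv (Coalgebra.comul a)) +
    LinearMap.mul' R S (TensorProduct.map f.ofConv (leftOp q g).ofConv (Coalgebra.comul a))
  rw [Bialgebra.comul_mul, hq, comul_augSection, ← hq, add_mul, map_add, map_add]
  congr 1
  · induction Coalgebra.comul (R := R) a with
    | zero => simp
    | tmul b c => simp [leftOp_apply]
    | add b c hb hc => simp only [mul_add, map_add, hb, hc]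
  · induction Coalgebra.comul (R := R) a with
    | zero => simp
    | tmul b c => simp [leftOp_apply]
    | add b c hb hc => simp only [mul_add, map_add, hb, hc]

omit [Coalgebra.IsCocomm R A] in
theorem ofConv_mul_one (f g : Fun R A S) : (f * g).ofConv 1 = f.ofConv 1 * g.ofConv 1 :=
  map_mul (counit R A S) f g

theorem leftOp_mem_pow (x : Primitive R A) {n : ℕ} {f : Fun R A S}
    (hf : f ∈ augIdeal R A S ^ (n + 1)) :
    leftOp (augSection R A x) f ∈ augIdeal R A S ^ n := by
  induction n generalizing f with
  | zero => simp
  | succ n ih =>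
    rw [pow_succ'] at hf
    refine Submodule.mul_induction_on hf (fun a ha b hb => ?_) fun a b ha hb => ?_
    · rw [leftOp_mul]
      refine add_mem (Ideal.mul_mem_left _ _ hb) ?_
      rw [pow_succ']
      exact Ideal.mul_mem_mul ha (ih hb)
    · rw [map_add]
      exact add_mem ha hb

/-- Each derivation lowers the power of `𝓘^*` by one; after `n` of them a form in `𝓘^*` is evaluated
at `1`. -/
theorem ofConv_prod_eq_zero {n : ℕ} (x : Fin n → Primitive R A) {f : Fun R A S}
    (hf : f ∈ augIdeal R A S ^ (n + 1)) :
    f.ofConv (List.ofFn fun i => augSection R A (x i)).prod = 0 := by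
  induction n generalizing f with
  | zero => simpa using mem_augIdeal.1 (by simpa using hf)
  | succ n ih =>
    rw [List.ofFn_succ, List.prod_cons, ← leftOp_apply]
    exact ih _ (leftOp_mem_pow _ hf)

/-- Differentiate by the first primitive element. The term where `g` is hit keeps `n + 1` factors in
`𝓘^*` against `n` primitives and vanishes; the others expand the permanent along a row. The factor
`g` is carried along to absorb the differentiated form, of which only the value at `1` matters. -/
theorem ofConv_mul_prod {n : ℕ} (x : Fin n → Primitive R A) (g : Fun R A S)
    (f : Fin n → PowModule R A 1 →ₗ[R] S) :
    (g * ∏ i, ofAug (f i)).ofConv (List.ofFn fun i => augSection R A (x i)).prod =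
      g.ofConv 1 * ∑ e : Equiv.Perm (Fin n), ∏ i, f (e i) (x i) := by
  induction n generalizing g with
  | zero => simp
  | succ n ih =>
    rw [List.ofFn_succ, List.prod_cons, ← leftOp_apply, leftOp_mul,
      leibniz_prod_fin _ (leftOp_mul _), Finset.mul_sum, sum_perm_succ (fun i j => f i (x j)),
      Finset.mul_sum]
    have h₁ : (leftOp (augSection R A (x 0)) g * ∏ i, ofAug (f i)).ofConv
        (List.ofFn fun i : Fin n => augSection R A (x i.succ)).prod = 0 :=
      ofConv_prod_eq_zero _ (Ideal.mul_mem_left _ _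
        (prod_mem_augIdeal_pow _ fun i => ofAug_mem _))
    have h₂ : ∀ (u v : Fun R A S) (a : A), (u + v).ofConv a = u.ofConv a + v.ofConv a :=
      fun _ _ _ => rfl
    have h₃ : ∀ (u : Fin (n + 1) → Fun R A S) (a : A),
        (∑ i, u i).ofConv a = ∑ i, (u i).ofConv a := fun u a =>
      map_sum ({ toFun := fun v => v.ofConv a, map_zero' := rfl, map_add' := fun _ _ => rfl } :
        Fun R A S →+ S) u _
    rw [h₂, h₁, zero_add, h₃]
    refine Finset.sum_congr rfl fun p _ => ?_
    rw [← mul_assoc, ih, ofConv_mul_one, leftOp_apply, mul_one, mul_assoc]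
    congr 2
    change f p (augProj R A (augSection R A (x 0))) = _
    rw [augProj_augSection]

variable (R A) in
/-- The map `P ⊗ ⋯ ⊗ P → A` given by the multiplication of `A`. -/
noncomputable def primMul (n : ℕ) : (⨂[R] _ : Fin n, Primitive R A) →ₗ[R] A :=
  PiTensorProduct.lift ((MultilinearMap.mkPiAlgebraFin R n A).compLinearMap
    fun _ => augSection R A ∘ₗ (Primitive R A).subtype)

theorem primMul_tprod {n : ℕ} (x : Fin n → Primitive R A) :
    primMul R A n (PiTensorProduct.tprod R x) =
      (List.ofFn fun i => augSection R A (x i)).prod := by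
  simp [primMul]

theorem tensorEval_iterComul_primMul {n : ℕ} (f : Fin n → PowModule R A 1 →ₗ[R] S)
    (z : ⨂[R] _ : Fin n, Primitive R A) :
    tensorEval f (iterComul R A n (primMul R A n z)) =
      ∑ e : Equiv.Perm (Fin n), tensorEval (fun i => f (e i) ∘ₗ (Primitive R A).subtype) z := by
  have := linearMap_apply_eq_of_tprod (f := tensorEval f ∘ₗ iterComul R A n ∘ₗ primMul R A n)
    (g := ∑ e : Equiv.Perm (Fin n), tensorEval (fun i => f (e i) ∘ₗ (Primitive R A).subtype))
    (fun x => by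
      rw [LinearMap.comp_apply, LinearMap.comp_apply, primMul_tprod, tensorEval_iterComul]
      have := ofConv_mul_prod x 1 f
      rw [one_mul] at this
      rw [this]
      simp [LinearMap.convOne_def]) z
  simpa using this

/-- The permanent formula is a sum over permutations, and its `n!` terms agree on a symmetric
tensor. -/
theorem iterComul_primMul {n : ℕ} {z : ⨂[R] _ : Fin n, Primitive R A}
    (hz : ∀ e : Equiv.Perm (Fin n), PiTensorProduct.reindex R (fun _ => Primitive R A) e z = z) :
    iterComul R A n (primMul R A n z) = n.factorial • primIncl R A n z :=
  eq_of_tensorEval fun S _ _ f => by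
    rw [tensorEval_iterComul_primMul, map_nsmul, tensorEval_map]
    have : ∀ e : Equiv.Perm (Fin n), tensorEval (fun i => f (e i) ∘ₗ (Primitive R A).subtype) z =
        tensorEval (fun i => f i ∘ₗ (Primitive R A).subtype) z := fun e => by
      conv_rhs => rw [← hz e]
      rw [tensorEval_reindex (fun i => f i ∘ₗ (Primitive R A).subtype)]
    simp only [this, Finset.sum_const, Finset.card_univ, Fintype.card_perm, Fintype.card_fin]

end Primitive

/-! ### Surjectivity by division by `n!`. -/

section Surjective

theorem eq_of_natCast_smul_eq {R M : Type*} [CommRing R] [Module.Flat ℤ R] [AddCommMonoid M]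
    [Module R M] [Module.Flat R M] {n : ℕ} (hn : n ≠ 0) {x y : M} (h : (n : R) • x = (n : R) • y) :
    x = y := by
  let : AddCommGroup M := Module.addCommMonoidToAddCommGroup R
  have : Module.Flat ℤ M := Module.Flat.trans ℤ R M
  have hne : (n : ℤ) ≠ 0 := Nat.cast_ne_zero.2 hn
  refine smul_right_injective M hne ?_
  change (n : ℤ) • x = (n : ℤ) • y
  rwa [natCast_zsmul, natCast_zsmul, ← Nat.cast_smul_eq_nsmul R, ← Nat.cast_smul_eq_nsmul R]

variable {R : Type u} [CommRing R] {A : Type u} [Ring A] [Bialgebra R A]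
  [Coalgebra.IsCocomm R A]

theorem primMul_zero_mem (z : ⨂[R] _ : Fin 0, Primitive R A) :
    primMul R A 0 z ∈ powVanishing R A 1 :=
  augProj_eq_zero.1 <| linearMap_apply_eq_of_tprod (f := augProj R A ∘ₗ primMul R A 0) (g := 0)
    (fun x => by rw [LinearMap.comp_apply, primMul_tprod]; simp [augProj_one]) z

/-- In a product of `n + 2` forms, merge the first two into one form in `𝓘^*`. Being in the square
of the ideal, it vanishes on `P = K_2 / K_1`, the first tensor factor of `z`. -/
theorem mem_powVanishing_of_iterComul_eq {n : ℕ} {b : A}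
    {z : ⨂[R] _ : Fin (n + 1), Primitive R A}
    (h : iterComul R A (n + 1) b = primIncl R A (n + 1) z) : b ∈ powVanishing R A (n + 2) := by
  refine mem_powVanishing_succ.2 fun S _ _ f hf => ?_
  choose g hg using fun i => exists_eq_ofAug (hf i)
  obtain ⟨g', hg'⟩ := exists_eq_ofAug (Ideal.mul_mem_left _ (f 0) (hf 1))
  have h₁ : ∏ i, f i = ∏ i : Fin (n + 1),
      ofAug ((Fin.cons g' fun j : Fin n => g j.succ.succ : Fin (n + 1) → _) i) := by
    rw [Fin.prod_univ_succ, Fin.prod_univ_succ, Fin.prod_univ_succ, Fin.cons_zero, ← hg', mul_assoc]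
    simp [hg]
  rw [h₁, ← tensorEval_iterComul, h, tensorEval_map]
  refine linearMap_apply_eq_of_tprod (g := 0) (fun x => ?_) z
  rw [tensorEval_tprod, Fin.prod_univ_succ, LinearMap.zero_apply]
  refine mul_eq_zero_of_left ?_ _
  obtain ⟨x₀, hx₀⟩ := x 0
  obtain ⟨a, rfl⟩ := augProj_surjective x₀
  have h₂ := mem_powVanishing.1 (augProj_mem_ker_powStep.1 hx₀) S (f 0 * f 1)
    (by rw [pow_two]; exact Ideal.mul_mem_mul (hf 0) (hf 1))
  rw [hg'] at h₂
  exact h₂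

theorem IsFlatInfinitesimal.exists_iterComul_eq [Module.Flat ℤ R] (hG : IsFlatInfinitesimal R A)
    {n : ℕ} {z : ⨂[R] _ : Fin n, Primitive R A}
    (hz : ∀ e : Equiv.Perm (Fin n), PiTensorProduct.reindex R (fun _ => Primitive R A) e z = z) :
    ∃ b ∈ powVanishing R A (n + 1), iterComul R A n b = primIncl R A n z := by
  have hμ := iterComul_primMul hz
  cases n with
  -- No division is needed, as `0! = 1`.
  | zero => exact ⟨_, primMul_zero_mem z, by rw [hμ, Nat.factorial_zero, one_smul]⟩
  | succ n =>
    have := hG.flat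
    have := flat_powModule_one (R := R) (A := A)
    let N : R := ((n + 1).factorial : ℕ)
    let I : Ideal R := Ideal.span {N}
    have hN : (Ideal.Quotient.mk I N : R ⧸ I) = 0 :=
      Ideal.Quotient.eq_zero_iff_mem.2 (Ideal.mem_span_singleton_self N)
    -- Modulo `N = (n + 1)!` the tensor `iterComul R A (n + 1) (primMul R A (n + 1) z)` is zero.
    have hy : (1 : R ⧸ I) ⊗ₜ[R] primMul R A (n + 1) z ∈
        powVanishing (R ⧸ I) ((R ⧸ I) ⊗[R] A) (n + 1) := by
      refine mem_powVanishing_baseChange ?_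
      rw [LinearMap.lTensor_tmul, hμ, ← Nat.cast_smul_eq_nsmul R, TensorProduct.tmul_smul,
        TensorProduct.smul_tmul']
      have : N • (1 : R ⧸ I) = 0 := by
        rw [Algebra.smul_def, mul_one]; exact hN
      rw [this, TensorProduct.zero_tmul]
    obtain ⟨v, hv⟩ := hG.mem_range_of_mem_powVanishing _ _ hy
    obtain ⟨v, rfl⟩ := LinearMap.rTensor_surjective _
      (g := (Ideal.Quotient.mkₐ R I).toLinearMap) (Ideal.Quotient.mkₐ_surjective R I) v
    obtain ⟨k, rfl⟩ := (TensorProduct.lid R _).symm.surjective v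
    have hk : (1 : R ⧸ I) ⊗ₜ[R] (primMul R A (n + 1) z - k) = 0 := by
      rw [TensorProduct.tmul_sub, ← hv]
      simp
    -- Base change supplies `k ∈ K_{n+1}` congruent to the product modulo `N`; the difference is `N
    -- b`, and `k` contributes nothing to `iterComul`.
    have hI : primMul R A (n + 1) z - k ∈ I • (⊤ : Submodule R A) := by
      have := congrArg (TensorProduct.quotTensorEquivQuotSMul A I) hk
      rw [TensorProduct.quotTensorEquivQuotSMul_mk_one_tmul, map_zero,
        Submodule.Quotient.mk_eq_zero] at this
      exact this
    rw [Submodule.ideal_span_singleton_smul, Submodule.mem_smul_pointwise_iff_exists] at hI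
    obtain ⟨b, -, hb⟩ := hI
    have h₁ : N • iterComul R A (n + 1) b = N • primIncl R A (n + 1) z := by
      rw [Nat.cast_smul_eq_nsmul R _ (primIncl R A (n + 1) z), ← hμ, ← map_smul]
      rw [hb, map_sub, iterComul_eq_zero k.2, sub_zero]
    have h₂ := eq_of_natCast_smul_eq (n + 1).factorial_ne_zero h₁
    exact ⟨b, mem_powVanishing_of_iterComul_eq h₂, h₂⟩

end Surjective

/-! ### Comparison inside `I^{⊗n}`, and the isomorphism. -/

section Main

variable {R : Type u} [CommRing R] {A : Type u} [Ring A] [Bialgebra R A]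
  [Coalgebra.IsCocomm R A]

/-- Cocommutativity enters as commutativity of the convolution product. -/
theorem reindex_iterComul {n : ℕ} (e : Equiv.Perm (Fin n)) (a : A) :
    PiTensorProduct.reindex R (fun _ => PowModule R A 1) e (iterComul R A n a) = iterComul R A n a :=
  eq_of_tensorEval fun S _ _ f => by
    rw [tensorEval_reindex, tensorEval_iterComul, tensorEval_iterComul]
    rw [Equiv.prod_comp e fun i => ofAug (f i)]

theorem IsFlatInfinitesimal.reindex_eq_of_primIncl_eq (hG : IsFlatInfinitesimal R A) {n : ℕ}
    {z : ⨂[R] _ : Fin n, Primitive R A} {a : A} (h : primIncl R A n z = iterComul R A n a)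
    (e : Equiv.Perm (Fin n)) :
    PiTensorProduct.reindex R (fun _ => Primitive R A) e z = z := by
  refine hG.primIncl_injective n ?_
  rw [h, ← reindex_iterComul e, ← h]
  exact PiTensorProduct.map_reindex (fun _ => (Primitive R A).subtype) e z

variable (R A) in
/-- The map `Ker(Iⁿ → Iⁿ⁺¹) → I ⊗ ⋯ ⊗ I` induced by the iterated reduced comultiplication. -/
noncomputable def grIterComul (n : ℕ) :
    LinearMap.ker (powStep R A n) →ₗ[R] ⨂[R] _ : Fin n, PowModule R A 1 :=
  (powVanishing R A n).liftQ (M₂ := ⨂[R] _ : Fin n, PowModule R A 1) (τ₁₂ := RingHom.id R)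
    (iterComul R A n) (fun _ hx => LinearMap.mem_ker.2 (iterComul_eq_zero hx)) ∘ₗ
    (LinearMap.ker (powStep R A n)).subtype

/-- The class in `Ker(Iⁿ → Iⁿ⁺¹)` of an element of `K_{n+1}`. -/
noncomputable def kerMk {n : ℕ} (a : A) (ha : a ∈ powVanishing R A (n + 1)) :
    LinearMap.ker (powStep R A n) :=
  ⟨(powVanishing R A n).mkQ a, (Submodule.Quotient.mk_eq_zero (powVanishing R A (n + 1))).2 ha⟩

theorem exists_eq_kerMk {n : ℕ} (x : LinearMap.ker (powStep R A n)) :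
    ∃ (a : A) (ha : a ∈ powVanishing R A (n + 1)), x = kerMk a ha := by
  obtain ⟨x, hx⟩ := x
  obtain ⟨a, rfl⟩ := Submodule.mkQ_surjective _ x
  exact ⟨a, (Submodule.Quotient.mk_eq_zero _).1 hx, rfl⟩

theorem grIterComul_kerMk {n : ℕ} (a : A) (ha : a ∈ powVanishing R A (n + 1)) :
    grIterComul R A n (kerMk a ha) = iterComul R A n a := rfl

theorem grIterComul_injective (n : ℕ) : Function.Injective (grIterComul R A n) := by
  refine (injective_iff_map_eq_zero _).2 fun x hx => ?_
  obtain ⟨a, ha, rfl⟩ := exists_eq_kerMk x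
  rw [grIterComul_kerMk, ← mem_powVanishing_iff ha] at hx
  exact Subtype.ext ((Submodule.Quotient.mk_eq_zero _).2 hx)

theorem grMk_apply_kerMk {n : ℕ} {S : Type u} [CommRing S] [Algebra R S] (f : Fun R A S)
    (hf : f ∈ augIdeal R A S ^ n) (a : A) (ha : a ∈ powVanishing R A (n + 1)) :
    (show LinearMap.ker (powStep R A n) →ₗ[R] S from grMk R A n f hf) (kerMk a ha) = f.ofConv a :=
  rfl

/-- The linear form on `A / R` of an element of `𝓘^*(S)`. -/
noncomputable def augForm {S : Type u} [CommRing S] [Algebra R S] (f : Fun R A S)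
    (hf : f ∈ augIdeal R A S ^ 1) : PowModule R A 1 →ₗ[R] S :=
  powMk R A 1 f hf

theorem ofAug_augForm {S : Type u} [CommRing S] [Algebra R S] (f : Fun R A S)
    (hf : f ∈ augIdeal R A S ^ 1) : ofAug (augForm f hf) = f := rfl

variable (R A) in
/-- The tensor in `I ⊗ ⋯ ⊗ I` of a linear form on `Sⁿ(𝓘^*/𝓘^{*2})`. -/
noncomputable def grDualTensor (n : ℕ) :
    Dual (symPow n (grScheme R A 1)) →ₗ[R] ⨂[R] _ : Fin n, PowModule R A 1 :=
  primIncl R A n ∘ₗ dualTensor n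

theorem IsFlatInfinitesimal.grDualTensor_injective (hG : IsFlatInfinitesimal R A) (n : ℕ) :
    Function.Injective (grDualTensor R A n) :=
  (hG.primIncl_injective n).comp dualTensor_injective

theorem tensorEval_grDualTensor {n : ℕ} (φ : Dual (symPow n (grScheme R A 1))) {S : Type u}
    [CommRing S] [Algebra R S] (f : Fin n → Fun R A S) (hf : ∀ i, f i ∈ augIdeal R A S ^ 1) :
    tensorEval (fun i => augForm (f i) (hf i))
      (grDualTensor R A n φ) =
      φ.val S (symProd (grScheme R A 1) S fun i => grMk R A 1 (f i) (hf i)) := by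
  refine (tensorEval_map _ _ _).trans ?_
  exact tensorEval_dualTensor φ _

/-- A linear map `P → S` is not assumed to extend to `I`. Those that do still separate linear forms,
because `P^{⊗n} → I^{⊗n}` is injective. -/
theorem IsFlatInfinitesimal.dual_eq_of_val_eq (hG : IsFlatInfinitesimal R A) {n : ℕ}
    {φ ψ : Dual (symPow n (grScheme R A 1))}
    (h : ∀ (S : Type u) [CommRing S] [Algebra R S] (f : Fin n → Fun R A S)
      (hf : ∀ i, f i ∈ augIdeal R A S ^ 1),
      φ.val S (symProd (grScheme R A 1) S fun i => grMk R A 1 (f i) (hf i)) =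
        ψ.val S (symProd (grScheme R A 1) S fun i => grMk R A 1 (f i) (hf i))) : φ = ψ := by
  refine hG.grDualTensor_injective n (eq_of_tensorEval fun S _ _ g => ?_)
  have hg : ∀ i, ofAug (g i) ∈ augIdeal R A S ^ 1 := fun i => by
    rw [pow_one]; exact ofAug_mem _
  have hg' : g = fun i => augForm (ofAug (g i)) (hg i) := by
    funext i
    refine LinearMap.ext fun x => ?_
    obtain ⟨a, rfl⟩ := augProj_surjective x
    rfl
  rw [hg', tensorEval_grDualTensor, tensorEval_grDualTensor]
  exact h S _ hg

/-- Both modules embed in `I^{⊗n}`. One inclusion of images comes from `exists_primIncl_comp_eq` and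
symmetry, the other from `exists_iterComul_eq`. -/
theorem IsFlatInfinitesimal.exists_linearEquiv [Module.Flat ℤ R] (hG : IsFlatInfinitesimal R A)
    (n : ℕ) : ∃ h : LinearMap.ker (powStep R A n) ≃ₗ[R] Dual (symPow n (grScheme R A 1)),
      ∀ x, grDualTensor R A n (h x) = grIterComul R A n x := by
  obtain ⟨h, hh⟩ := exists_comp_eq_of_mem_range (f := grIterComul R A n)
    (hG.grDualTensor_injective n) fun x => by
      obtain ⟨a, ha, rfl⟩ := exists_eq_kerMk x
      obtain ⟨t, ht⟩ := hG.exists_primIncl_comp_eq n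
      have hta : primIncl R A n (t ⟨a, ha⟩) = iterComul R A n a := LinearMap.congr_fun ht ⟨a, ha⟩
      refine ⟨dualOfSymmetric (t ⟨a, ha⟩) (hG.reindex_eq_of_primIncl_eq hta), ?_⟩
      rw [grIterComul_kerMk, ← hta]
      exact congrArg (primIncl R A n) (dualTensor_dualOfSymmetric _ _)
  have hh' : ∀ x, grDualTensor R A n (h x) = grIterComul R A n x := LinearMap.congr_fun hh
  refine ⟨LinearEquiv.ofBijective h ⟨fun x y hxy => grIterComul_injective n ?_, fun φ => ?_⟩, hh'⟩
  · rw [← hh', ← hh', hxy]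
  · obtain ⟨b, hb, hbφ⟩ := hG.exists_iterComul_eq (z := dualTensor n φ) (reindex_dualTensor φ)
    refine ⟨kerMk b hb, hG.grDualTensor_injective n ?_⟩
    rw [hh', grIterComul_kerMk, hbφ]
    rfl

theorem isIso_dualHom {M : Type v} {N : Type w} [AddCommGroup M] [Module R M] [AddCommGroup N]
    [Module R N] (h : N ≃ₗ[R] M) : (dualHom h.toLinearMap).IsIso := by
  refine ⟨dualHom h.symm.toLinearMap, Hom.ext ?_, Hom.ext ?_⟩
  · funext S _ _
    refine LinearMap.ext fun (f : M →ₗ[R] S) => LinearMap.ext fun x => ?_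
    exact congrArg f (h.apply_symm_apply x)
  · funext S _ _
    refine LinearMap.ext fun (f : N →ₗ[R] S) => LinearMap.ext fun x => ?_
    exact congrArg f (h.symm_apply_apply x)

/-- Dual form of the condition on `m`: `h x` must take on products of classes the values prescribed
by the tensor of `x`. -/
theorem isMultiplication_dualHom_iff {n : ℕ}
    (h : LinearMap.ker (powStep R A n) →ₗ[R] Dual (symPow n (grScheme R A 1))) :
    IsMultiplication R A n (dualHom h) ↔ ∀ (x : LinearMap.ker (powStep R A n)) (S : Type u)
      [CommRing S] [Algebra R S] (f : Fin n → Fun R A S) (hf : ∀ i, f i ∈ augIdeal R A S ^ 1),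
      (h x).val S (symProd (grScheme R A 1) S fun i => grMk R A 1 (f i) (hf i)) =
        tensorEval (fun i => augForm (f i) (hf i))
          (grIterComul R A n x) := by
  have key : ∀ (S : Type u) [CommRing S] [Algebra R S] (f : Fin n → Fun R A S)
      (hf : ∀ i, f i ∈ augIdeal R A S ^ 1) (hf' : ∏ i, f i ∈ augIdeal R A S ^ n)
      (x : LinearMap.ker (powStep R A n)),
      (show LinearMap.ker (powStep R A n) →ₗ[R] S from grMk R A n (∏ i, f i) hf') x =
        tensorEval (fun i => augForm (f i) (hf i))
          (grIterComul R A n x) := fun S _ _ f hf hf' x => by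
    obtain ⟨a, ha, rfl⟩ := exists_eq_kerMk x
    rw [grMk_apply_kerMk, grIterComul_kerMk, tensorEval_iterComul]
    simp only [ofAug_augForm]
  constructor
  · intro hm x S _ _ f hf
    have := hm S f fun i => by simpa using hf i
    refine Eq.trans ?_ (key S f hf (prod_mem_augIdeal_pow f fun i => by simpa using hf i) x)
    exact LinearMap.congr_fun (this : (_ : LinearMap.ker (powStep R A n) →ₗ[R] S) = _) x
  · intro hm S _ _ f hf
    refine LinearMap.ext fun (x : LinearMap.ker (powStep R A n)) => ?_
    refine Eq.trans ?_ (key S f (fun i => by simpa using hf i) (prod_mem_augIdeal_pow f hf) x).symm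
    exact hm x S f _

theorem IsFlatInfinitesimal.exists_isIso [Module.Flat ℤ R] (hG : IsFlatInfinitesimal R A) (n : ℕ) :
    ∃ m : Hom (schemeClosure (symPow n (grScheme R A 1))) (grScheme R A n),
      m.IsIso ∧ IsMultiplication R A n m ∧ ∀ m', IsMultiplication R A n m' → m' = m := by
  obtain ⟨h, hh⟩ := hG.exists_linearEquiv n
  refine ⟨dualHom h.toLinearMap, isIso_dualHom h, ?_, fun m' hm' => ?_⟩
  · rw [isMultiplication_dualHom_iff]
    intro x S _ _ f hf
    rw [← hh, tensorEval_grDualTensor]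
    rfl
  -- The module of linear forms lives in a larger universe than the test algebras, so `m'` is first
  -- transported along `h` to the small module `Ker(Iⁿ → Iⁿ⁺¹)`, where Yoneda applies.
  · obtain ⟨j, hj⟩ := exists_eq_dualHom (m'.comp (dualHom h.symm.toLinearMap))
    have hm : m' = dualHom (h.toLinearMap ∘ₗ j) := by
      have h₁ : m' = (m'.comp (dualHom h.symm.toLinearMap)).comp (dualHom h.toLinearMap) := by
        refine Hom.ext ?_
        funext S _ _
        refine LinearMap.ext fun (f : Dual (symPow n (grScheme R A 1)) →ₗ[R] S) =>
          congrArg (m'.app S) (LinearMap.ext fun x => ?_)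
        exact congrArg f (h.apply_symm_apply x).symm
      rw [h₁, hj]
      rfl
    subst hm
    congr 1
    refine LinearMap.ext fun x => hG.dual_eq_of_val_eq fun S _ _ f hf => ?_
    rw [(isMultiplication_dualHom_iff _).1 hm' x S f hf, ← hh, tensorEval_grDualTensor]
    rfl

end Main

end FormalMonoid
theorem mainTheorem9 (R : Type u) [CommRing R] [Module.Flat ℤ R]
    (A : Type u) [Ring A] [Bialgebra R A] [Coalgebra.IsCocomm R A]
    (hG : FormalMonoid.IsFlatInfinitesimal R A) (n : ℕ) :
    (∃! m : ModuleFunctor.Hom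
        (ModuleFunctor.schemeClosure (ModuleFunctor.symPow n (FormalMonoid.grScheme R A 1)))
        (FormalMonoid.grScheme R A n),
      FormalMonoid.IsMultiplication R A n m) ∧
    ∀ m : ModuleFunctor.Hom
        (ModuleFunctor.schemeClosure (ModuleFunctor.symPow n (FormalMonoid.grScheme R A 1)))
        (FormalMonoid.grScheme R A n),
      FormalMonoid.IsMultiplication R A n m → m.IsIso := by
  obtain ⟨m, hiso, hm, huniq⟩ := hG.exists_isIso n
  exact ⟨⟨m, hm, huniq⟩, fun m' hm' => huniq m' hm' ▸ hiso⟩
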